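/- Let $\Omega$ be the category of finite rooted trees (top edges may be leaves or stumps): a morphism $S \to T$ is a map $\Omega(S) \to \Omega(T)$ of coloured symmetric operads, where $\Omega(T)$ has the edges of $T$ as colours and is freely generated by the vertices of $T$. A dendroidal set is a presheaf of sets on $\Omega$; write $\Omega[T]$ for the presheaf represented by $T$, and $N(P)_T = \mathrm{Hom}(\Omega(T), P)$ for the dendroidal nerve of an operad $P$. Let $\otimes$ be the tensor product of dendroidal sets, i.e. the extension, preserving colimits in each variable, of $\Omega[S] \otimes \Omega[T] = N(\Omega(S) \otimes_{BV} \Omega(T))$, where $\otimes_{BV}$ is the Boardman–Vogt tensor product of operads, and let $Y^X$ be the corresponding internal hom, $(Y^X)_T = \mathrm{Hom}(X \otimes \Omega[T], Y)$. Let $i \colon \Delta \hookrightarrow \Omega$ be the inclusion sending $[n]$ to the linear tree with $n$ vertices and one leaf, $i^*$ the restriction along $i$ from dendroidal sets to simplicial sets, and $i_!$ its left adjoint. For a simplicial set $M$ and dendroidal sets $X, Y$, put $Y^M := Y^{i_! M}$ (the cotensor) and $\mathrm{sHom}(X, Y) := i^*(Y^X)$ (the simplicial hom). The size $|T|$ of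 a tree is the number of its non-root edges plus the number of its vertices; for a dendroidal set $X$, $\mathrm{cosk}_n X$ denotes the right Kan extension of the restriction of $X$ to the full subcategory of trees of size at most $n$. A dendroidal set $X$ is degreewise finite if every $X_T$ is finite, and lean if it is degreewise finite and $X \to \mathrm{cosk}_n X$ is an isomorphism for some $n \geq 0$. Likewise, a simplicial set $M$ is degreewise finite if every $M_n$ is finite, and lean if it is degreewise finite and the canonical map $M \to \mathrm{cosk}_n M$ to its $n$-coskeleton (the right Kan extension of its restriction to $\Delta_{\leq n}$) is an isomorphism for some $n \geq 0$. **Lemma.** Let $Y$ be a lean dendroidal set. Then for every degreewise finite simplicial set $M$, the cotensor $Y^M$ is a lean dendroidal set, and for every degreewise finite dendroidal set $X$, the simplicial hom $\mathrm{sHom}(X, Y)$ is a lean simplicial set. -/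

import Mathlib

open CategoryTheory Opposite

namespace Dendroidal

/-! ## Coloured symmetric operads -/

/-- A coloured symmetric operad in sets. `Op n` is the set of all `n`-ary operations; an operation
`p` has input colours `src p` and an output colour `tgt p`, so that the set usually written
`P(c₁, …, cₙ; d)` is the set of `p` with `src p = (c₁, …, cₙ)` and `tgt p = d`.

The composition and the action of the symmetric groups are combined in one operation:
`comp p q h e` is the composite `p ∘ (q₁, …, qₙ)`, whose inputs are the pairs `(i, j)` with `j` an
input of `qᵢ`, and these inputs are then listed in the order prescribed by the bijection `e`.
(Taking all `qᵢ` to be units gives the symmetric group actions; their usual equivariance axioms are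
instances of `assoc` and the unit laws.) -/
structure Operad : Type 1 where
  /-- the colours -/
  Col : Type
  /-- the operations of a given arity -/
  Op : ℕ → Type
  /-- the input colours of an operation -/
  src : ∀ {n : ℕ}, Op n → Fin n → Col
  /-- the output colour of an operation -/
  tgt : ∀ {n : ℕ}, Op n → Col
  /-- the unit operations -/
  unit : Col → Op 1
  /-- composition followed by a reordering of the inputs -/
  comp : ∀ {n m : ℕ} {k : Fin n → ℕ} (p : Op n) (q : ∀ i, Op (k i)),
    (∀ i, tgt (q i) = src p i) → ((Σ i, Fin (k i)) ≃ Fin m) → Op m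
  src_unit : ∀ (c : Col) (i : Fin 1), src (unit c) i = c
  tgt_unit : ∀ c : Col, tgt (unit c) = c
  src_comp : ∀ {n m : ℕ} {k : Fin n → ℕ} (p : Op n) (q : ∀ i, Op (k i))
    (h : ∀ i, tgt (q i) = src p i) (e : (Σ i, Fin (k i)) ≃ Fin m) (i : Fin n) (j : Fin (k i)),
    src (comp p q h e) (e ⟨i, j⟩) = src (q i) j
  tgt_comp : ∀ {n m : ℕ} {k : Fin n → ℕ} (p : Op n) (q : ∀ i, Op (k i))
    (h : ∀ i, tgt (q i) = src p i) (e : (Σ i, Fin (k i)) ≃ Fin m), tgt (comp p q h e) = tgt p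
  unit_comp : ∀ {n : ℕ} (p : Op n) (e : (Σ _ : Fin 1, Fin n) ≃ Fin n), (∀ j, e ⟨0, j⟩ = j) →
    comp (unit (tgt p)) (fun _ => p) (fun i => (src_unit _ i).symm) e = p
  comp_unit : ∀ {n : ℕ} (p : Op n) (e : (Σ _ : Fin n, Fin 1) ≃ Fin n), (∀ i, e ⟨i, 0⟩ = i) →
    comp p (fun i => unit (src p i)) (fun _ => tgt_unit _) e = p
  assoc : ∀ {n m N : ℕ} {k : Fin n → ℕ} {l : Fin m → ℕ} {M : Fin n → ℕ}
    (p : Op n) (q : ∀ i, Op (k i)) (h : ∀ i, tgt (q i) = src p i) (e : (Σ i, Fin (k i)) ≃ Fin m)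
    (r : ∀ x, Op (l x)) (h' : ∀ x, tgt (r x) = src (comp p q h e) x)
    (e' : (Σ x, Fin (l x)) ≃ Fin N)
    (f : ∀ i, (Σ j, Fin (l (e ⟨i, j⟩))) ≃ Fin (M i)) (f' : (Σ i, Fin (M i)) ≃ Fin N),
    (∀ i j y, e' ⟨e ⟨i, j⟩, y⟩ = f' ⟨i, f i ⟨j, y⟩⟩) →
    comp (comp p q h e) r h' e' =
      comp p
        (fun i => comp (q i) (fun j => r (e ⟨i, j⟩))
          (fun j => (h' _).trans (src_comp p q h e i j)) (f i))
        (fun i => (tgt_comp _ _ _ _).trans (h i)) f'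

namespace Operad

/-- Maps of coloured symmetric operads. -/
@[ext]
structure Hom (P Q : Operad) where
  /-- the effect on colours -/
  onCol : P.Col → Q.Col
  /-- the effect on operations -/
  onOp : ∀ {n : ℕ}, P.Op n → Q.Op n
  src_onOp : ∀ {n : ℕ} (p : P.Op n) (i : Fin n), Q.src (onOp p) i = onCol (P.src p i)
  tgt_onOp : ∀ {n : ℕ} (p : P.Op n), Q.tgt (onOp p) = onCol (P.tgt p)
  onOp_unit : ∀ c : P.Col, onOp (P.unit c) = Q.unit (onCol c)
  onOp_comp : ∀ {n m : ℕ} {k : Fin n → ℕ} (p : P.Op n) (q : ∀ i, P.Op (k i))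
    (h : ∀ i, P.tgt (q i) = P.src p i) (e : (Σ i, Fin (k i)) ≃ Fin m),
    onOp (P.comp p q h e) =
      Q.comp (onOp p) (fun i => onOp (q i))
        (fun i => by rw [tgt_onOp, src_onOp, h i]) e

instance : LargeCategory Operad where
  Hom := Hom
  id P := ⟨id, id, fun _ _ => rfl, fun _ => rfl, fun _ => rfl, fun _ _ _ _ => rfl⟩
  comp f g :=
    { onCol := g.onCol ∘ f.onCol
      onOp := g.onOp ∘ f.onOp
      src_onOp := fun p i => by simp [g.src_onOp, f.src_onOp]
      tgt_onOp := fun p => by simp [g.tgt_onOp, f.tgt_onOp]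
      onOp_unit := fun c => by simp [g.onOp_unit, f.onOp_unit]
      onOp_comp := fun p q h e => by simp [g.onOp_comp, f.onOp_comp] }

end Operad

/-! ## The Boardman–Vogt tensor product of operads -/

/-- Formal composites of the generating operations `p ⊗ d` (`left`) and `c ⊗ q` (`right`), for
`p` an operation and `c` a colour of `P`, and `q` an operation and `d` a colour of `Q`. -/
inductive BVTerm (P Q : Operad) : ℕ → Type
  | left {n : ℕ} (p : P.Op n) (d : Q.Col) : BVTerm P Q n
  | right {n : ℕ} (c : P.Col) (q : Q.Op n) : BVTerm P Q n
  | unit (x : P.Col × Q.Col) : BVTerm P Q 1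
  | comp {n m : ℕ} {k : Fin n → ℕ} (p : BVTerm P Q n) (q : ∀ i, BVTerm P Q (k i))
      (e : (Σ i, Fin (k i)) ≃ Fin m) : BVTerm P Q m

namespace BVTerm

variable {P Q : Operad}

/-- The input colours of a formal composite. -/
def src : ∀ {n : ℕ}, BVTerm P Q n → Fin n → P.Col × Q.Col
  | _, left p d, i => (P.src p i, d)
  | _, right c q, i => (c, Q.src q i)
  | _, unit x, _ => x
  | _, comp _ q e, x => src (q (e.symm x).1) (e.symm x).2

/-- The output colour of a formal composite. -/
def tgt : ∀ {n : ℕ}, BVTerm P Q n → P.Col × Q.Col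
  | _, left p d => (P.tgt p, d)
  | _, right c q => (c, Q.tgt q)
  | _, unit x => x
  | _, comp p _ _ => tgt p

/-- A formal composite is well formed if the colours match in all the compositions in it. -/
def WF : ∀ {n : ℕ}, BVTerm P Q n → Prop
  | _, left _ _ => True
  | _, right _ _ => True
  | _, unit _ => True
  | _, comp p q _ => WF p ∧ (∀ i, WF (q i)) ∧ ∀ i, tgt (q i) = src p i

/-- The relations of the Boardman–Vogt tensor product: the smallest congruence satisfying the
axioms of an operad and such that `p ↦ p ⊗ d` and `q ↦ c ⊗ q` are maps of operads, and such that
the interchange relation between `P` and `Q` holds. -/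
inductive Rel : ∀ {n : ℕ}, BVTerm P Q n → BVTerm P Q n → Prop
  | refl {n : ℕ} (s : BVTerm P Q n) : Rel s s
  | symm {n : ℕ} {s t : BVTerm P Q n} : Rel s t → Rel t s
  | trans {n : ℕ} {s t u : BVTerm P Q n} : Rel s t → Rel t u → Rel s u
  | congr {n m : ℕ} {k : Fin n → ℕ} {p p' : BVTerm P Q n} {q q' : ∀ i, BVTerm P Q (k i)}
      (e : (Σ i, Fin (k i)) ≃ Fin m) :
      Rel p p' → (∀ i, Rel (q i) (q' i)) → Rel (comp p q e) (comp p' q' e)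
  | unit_comp {n : ℕ} (p : BVTerm P Q n) (e : (Σ _ : Fin 1, Fin n) ≃ Fin n) :
      (∀ j, e ⟨0, j⟩ = j) → Rel (comp (unit (tgt p)) (fun _ => p) e) p
  | comp_unit {n : ℕ} (p : BVTerm P Q n) (e : (Σ _ : Fin n, Fin 1) ≃ Fin n) :
      (∀ i, e ⟨i, 0⟩ = i) → Rel (comp p (fun i => unit (src p i)) e) p
  | assoc {n m N : ℕ} {k : Fin n → ℕ} {l : Fin m → ℕ} {M : Fin n → ℕ}
      (p : BVTerm P Q n) (q : ∀ i, BVTerm P Q (k i)) (e : (Σ i, Fin (k i)) ≃ Fin m)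
      (r : ∀ x, BVTerm P Q (l x)) (e' : (Σ x, Fin (l x)) ≃ Fin N)
      (f : ∀ i, (Σ j, Fin (l (e ⟨i, j⟩))) ≃ Fin (M i)) (f' : (Σ i, Fin (M i)) ≃ Fin N) :
      (∀ i j y, e' ⟨e ⟨i, j⟩, y⟩ = f' ⟨i, f i ⟨j, y⟩⟩) →
      Rel (comp (comp p q e) r e')
        (comp p (fun i => comp (q i) (fun j => r (e ⟨i, j⟩)) (f i)) f')
  | left_unit (c : P.Col) (d : Q.Col) : Rel (left (P.unit c) d) (unit (c, d))
  | left_comp {n m : ℕ} {k : Fin n → ℕ} (p : P.Op n) (q : ∀ i, P.Op (k i))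
      (h : ∀ i, P.tgt (q i) = P.src p i) (e : (Σ i, Fin (k i)) ≃ Fin m) (d : Q.Col) :
      Rel (left (P.comp p q h e) d) (comp (left p d) (fun i => left (q i) d) e)
  | right_unit (c : P.Col) (d : Q.Col) : Rel (right c (Q.unit d)) (unit (c, d))
  | right_comp {n m : ℕ} {k : Fin n → ℕ} (c : P.Col) (p : Q.Op n) (q : ∀ i, Q.Op (k i))
      (h : ∀ i, Q.tgt (q i) = Q.src p i) (e : (Σ i, Fin (k i)) ≃ Fin m) :
      Rel (right c (Q.comp p q h e)) (comp (right c p) (fun i => right c (q i)) e)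
  | interchange {n m N : ℕ} (p : P.Op n) (q : Q.Op m)
      (e : (Σ _ : Fin n, Fin m) ≃ Fin N) (e' : (Σ _ : Fin m, Fin n) ≃ Fin N) :
      (∀ i j, e ⟨i, j⟩ = e' ⟨j, i⟩) →
      Rel (comp (left p (Q.tgt q)) (fun i => right (P.src p i) q) e)
        (comp (right (P.tgt p) q) (fun j => left p (Q.src q j)) e')

theorem src_comp_apply {n m : ℕ} {k : Fin n → ℕ} (p : BVTerm P Q n) (q : ∀ i, BVTerm P Q (k i))
    (e : (Σ i, Fin (k i)) ≃ Fin m) (z : Σ i, Fin (k i)) :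
    src (comp p q e) (e z) = src (q z.1) z.2 := by
  rw [src, Equiv.symm_apply_apply]

/-- Related formal composites have the same inputs and output, and one of them is well formed
if and only if the other is. -/
theorem Rel.sound {n : ℕ} {s t : BVTerm P Q n} (h : Rel s t) :
    src s = src t ∧ tgt s = tgt t ∧ (WF s ↔ WF t) := by
  induction h with
  | refl => exact ⟨rfl, rfl, Iff.rfl⟩
  | symm _ ih => exact ⟨ih.1.symm, ih.2.1.symm, ih.2.2.symm⟩
  | trans _ _ ih ih' =>
    exact ⟨ih.1.trans ih'.1, ih.2.1.trans ih'.2.1, ih.2.2.trans ih'.2.2⟩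
  | congr e _ _ ih ih' =>
    refine ⟨?_, ?_, ?_⟩
    · funext x
      simp only [src, (ih' _).1]
    · simp only [tgt, ih.2.1]
    · simp only [WF, ih.2.2, (ih' _).2.2, (ih' _).2.1, ih.1]
  | unit_comp p e he =>
    refine ⟨?_, rfl, ?_⟩
    · funext x
      obtain ⟨⟨i, j⟩, rfl⟩ := e.surjective x
      rw [src_comp_apply]
      obtain rfl : i = 0 := Subsingleton.elim _ _
      rw [he]
    · simp [WF, src]
  | comp_unit p e he =>
    refine ⟨?_, rfl, ?_⟩
    · funext x
      obtain ⟨⟨i, j⟩, rfl⟩ := e.surjective x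
      rw [src_comp_apply]
      obtain rfl : j = 0 := Subsingleton.elim _ _
      rw [he]
      rfl
    · simp [WF, tgt]
  | assoc p q e r e' f f' hf =>
    refine ⟨?_, rfl, ?_⟩
    · funext x
      obtain ⟨⟨x, y⟩, rfl⟩ := e'.surjective x
      obtain ⟨⟨i, j⟩, rfl⟩ := e.surjective x
      rw [src_comp_apply, hf, src_comp_apply, src_comp_apply]
    · have key : (∀ x, tgt (r x) = src (comp p q e) x) ↔
          ∀ i j, tgt (r (e ⟨i, j⟩)) = src (q i) j := by
        constructor
        · intro h i j
          rw [h, src_comp_apply]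
        · intro h x
          obtain ⟨⟨i, j⟩, rfl⟩ := e.surjective x
          rw [h, src_comp_apply]
      have key' : (∀ x, WF (r x)) ↔ ∀ i j, WF (r (e ⟨i, j⟩)) := by
        constructor
        · intro h i j
          exact h _
        · intro h x
          obtain ⟨⟨i, j⟩, rfl⟩ := e.surjective x
          exact h _ _
      simp only [WF, key, key', tgt]
      constructor
      · rintro ⟨⟨h1, h2, h3⟩, h4, h5⟩
        exact ⟨h1, fun i => ⟨h2 i, h4 i, h5 i⟩, h3⟩
      · rintro ⟨h1, h2, h3⟩
        exact ⟨⟨h1, fun i => (h2 i).1, h3⟩, fun i => (h2 i).2.1, fun i => (h2 i).2.2⟩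
  | left_unit c d =>
    refine ⟨?_, ?_, Iff.rfl⟩
    · funext x
      simp [src, P.src_unit]
    · simp [tgt, P.tgt_unit]
  | left_comp p q h e d =>
    refine ⟨?_, ?_, ?_⟩
    · funext x
      obtain ⟨⟨i, j⟩, rfl⟩ := e.surjective x
      rw [src_comp_apply]
      simp [src, P.src_comp]
    · simp [tgt, P.tgt_comp]
    · simp [WF, tgt, src, h]
  | right_unit c d =>
    refine ⟨?_, ?_, Iff.rfl⟩
    · funext x
      simp [src, Q.src_unit]
    · simp [tgt, Q.tgt_unit]
  | right_comp c p q h e =>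
    refine ⟨?_, ?_, ?_⟩
    · funext x
      obtain ⟨⟨i, j⟩, rfl⟩ := e.surjective x
      rw [src_comp_apply]
      simp [src, Q.src_comp]
    · simp [tgt, Q.tgt_comp]
    · simp [WF, tgt, src, h]
  | interchange p q e e' he =>
    refine ⟨?_, rfl, ?_⟩
    · funext x
      obtain ⟨⟨i, j⟩, rfl⟩ := e.surjective x
      rw [src_comp_apply, he, src_comp_apply]
      rfl
    · simp [WF, tgt, src]

variable (P Q) in
/-- The equivalence relation on well formed formal composites. -/
def setoid (n : ℕ) : Setoid {t : BVTerm P Q n // WF t} where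
  r s t := Rel s.1 t.1
  iseqv := ⟨fun s => .refl s.1, .symm, .trans⟩

/-- The effect of a pair of operad maps on formal composites. -/
def map {P' Q' : Operad} (f : P ⟶ P') (g : Q ⟶ Q') : ∀ {n : ℕ}, BVTerm P Q n → BVTerm P' Q' n
  | _, left p d => left (f.onOp p) (g.onCol d)
  | _, right c q => right (f.onCol c) (g.onOp q)
  | _, unit x => unit (f.onCol x.1, g.onCol x.2)
  | _, comp p q e => comp (map f g p) (fun i => map f g (q i)) e

section map

variable {P' Q' : Operad} (f : P ⟶ P') (g : Q ⟶ Q')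

theorem src_map {n : ℕ} (t : BVTerm P Q n) :
    ∀ i, src (map f g t) i = (f.onCol (src t i).1, g.onCol (src t i).2) := by
  induction t with
  | left p d => intro i; simp [map, src, f.src_onOp]
  | right c q => intro i; simp [map, src, g.src_onOp]
  | unit x => intro i; rfl
  | comp p q e ihp ihq => intro i; simp [map, src, ihq]

theorem tgt_map {n : ℕ} (t : BVTerm P Q n) :
    tgt (map f g t) = (f.onCol (tgt t).1, g.onCol (tgt t).2) := by
  induction t with
  | left p d => simp [map, tgt, f.tgt_onOp]
  | right c q => simp [map, tgt, g.tgt_onOp]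
  | unit x => rfl
  | comp p q e ihp ihq => simp [map, tgt, ihp]

theorem WF.map {n : ℕ} {t : BVTerm P Q n} (h : WF t) : WF (map f g t) := by
  induction t with
  | left p d => trivial
  | right c q => trivial
  | unit x => trivial
  | comp p q e ihp ihq =>
    obtain ⟨h1, h2, h3⟩ := h
    exact ⟨ihp h1, fun i => ihq i (h2 i), fun i => by rw [tgt_map, src_map, h3]⟩

theorem Rel.map {n : ℕ} {s t : BVTerm P Q n} (h : Rel s t) :
    Rel (map f g s) (map f g t) := by
  induction h with
  | refl => exact .refl _
  | symm _ ih => exact .symm ih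
  | trans _ _ ih ih' => exact .trans ih ih'
  | congr e _ _ ih ih' => exact .congr e ih ih'
  | unit_comp p e he =>
    have := Rel.unit_comp (BVTerm.map f g p) e he
    rwa [tgt_map] at this
  | comp_unit p e he =>
    have := Rel.comp_unit (BVTerm.map f g p) e he
    simp only [src_map] at this
    exact this
  | assoc p q e r e' u u' hu => exact .assoc _ _ _ _ _ _ _ hu
  | left_unit c d =>
    simp only [BVTerm.map, f.onOp_unit]
    exact .left_unit _ _
  | left_comp p q h e d =>
    simp only [BVTerm.map, f.onOp_comp]
    exact .left_comp _ _ _ _ _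
  | right_unit c d =>
    simp only [BVTerm.map, g.onOp_unit]
    exact .right_unit _ _
  | right_comp c p q h e =>
    simp only [BVTerm.map, g.onOp_comp]
    exact .right_comp _ _ _ _ _
  | interchange p q e e' he =>
    have := Rel.interchange (f.onOp p) (g.onOp q) e e' he
    simp only [f.src_onOp, g.src_onOp, f.tgt_onOp, g.tgt_onOp] at this
    exact this

end map

end BVTerm

/-- The Boardman–Vogt tensor product `P ⊗ Q` of two operads. -/
noncomputable def bvTensor (P Q : Operad) : Operad where
  Col := P.Col × Q.Col
  Op n := Quotient (BVTerm.setoid P Q n)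
  src := Quotient.lift (fun t => BVTerm.src t.1) fun _ _ h => (BVTerm.Rel.sound h).1
  tgt := Quotient.lift (fun t => BVTerm.tgt t.1) fun _ _ h => (BVTerm.Rel.sound h).2.1
  unit x := Quotient.mk _ ⟨.unit x, trivial⟩
  comp p q h e := Quotient.mk _ ⟨.comp p.out.1 (fun i => (q i).out.1) e, p.out.2,
    fun i => (q i).out.2, fun i => by
      have := h i
      rw [← Quotient.out_eq p, ← Quotient.out_eq (q i)] at this
      exact this⟩
  src_unit _ _ := rfl
  tgt_unit _ := rfl
  src_comp p q h e i j := by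
    conv_rhs => rw [← Quotient.out_eq (q i)]
    exact BVTerm.src_comp_apply p.out.1 (fun i => (q i).out.1) e ⟨i, j⟩
  tgt_comp p q h e := by
    conv_rhs => rw [← Quotient.out_eq p]
    rfl
  unit_comp p e he := by
    induction p using Quotient.inductionOn with | h p => ?_
    refine Quotient.sound ?_
    exact ((BVTerm.Rel.congr e (Quotient.mk_out (s := BVTerm.setoid P Q 1) _)
      (fun _ => Quotient.mk_out (s := BVTerm.setoid P Q _) p)).trans (BVTerm.Rel.unit_comp p.1 e he))
  comp_unit p e he := by
    induction p using Quotient.inductionOn with | h p => ?_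
    refine Quotient.sound ?_
    exact ((BVTerm.Rel.congr e (Quotient.mk_out (s := BVTerm.setoid P Q _) p)
      (fun _ => Quotient.mk_out (s := BVTerm.setoid P Q 1) _)).trans
        (BVTerm.Rel.comp_unit p.1 e he))
  assoc p q h e r h' e' f f' hf := by
    refine Quotient.sound ?_
    refine (BVTerm.Rel.congr e' (Quotient.mk_out (s := BVTerm.setoid P Q _) _)
      (fun _ => .refl _)).trans ?_
    refine (BVTerm.Rel.assoc _ _ _ _ _ f f' hf).trans ?_
    exact BVTerm.Rel.congr f' (.refl _)
      (fun i => .symm (Quotient.mk_out (s := BVTerm.setoid P Q _) _))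

/-- The Boardman–Vogt tensor product of maps of operads. -/
noncomputable def bvTensorMap {P P' Q Q' : Operad} (f : P ⟶ P') (g : Q ⟶ Q') :
    bvTensor P Q ⟶ bvTensor P' Q' where
  onCol x := (f.onCol x.1, g.onCol x.2)
  onOp := Quotient.map' (fun t => ⟨BVTerm.map f g t.1, t.2.map f g⟩) fun _ _ h => BVTerm.Rel.map f g h
  src_onOp p i := by
    induction p using Quotient.inductionOn with | h p => ?_
    exact BVTerm.src_map f g p.1 i
  tgt_onOp p := by
    induction p using Quotient.inductionOn with | h p => ?_
    exact BVTerm.tgt_map f g p.1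
  onOp_unit _ := rfl
  onOp_comp p q h e := by
    have key : ∀ (l : ℕ) (x : Quotient (BVTerm.setoid P Q l)),
        BVTerm.Rel (BVTerm.map f g x.out.1)
          (Quotient.map' (s₂ := BVTerm.setoid P' Q' l)
            (fun t => ⟨BVTerm.map f g t.1, t.2.map f g⟩) (fun _ _ h => BVTerm.Rel.map f g h) x).out.1 := by
      intro l x
      conv_rhs => rw [← Quotient.out_eq x]
      exact .symm (Quotient.mk_out (s := BVTerm.setoid P' Q' l) _)
    exact Quotient.sound (BVTerm.Rel.congr e (key _ p) fun i => key _ (q i))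

theorem Operad.hom_ext {P Q : Operad} {f g : P ⟶ Q} (h : f.onCol = g.onCol)
    (h' : ∀ (n : ℕ) (p : P.Op n), f.onOp p = g.onOp p) : f = g :=
  Operad.Hom.ext h (by funext n p; exact h' n p)

theorem bvTensorMap_id (P Q : Operad) :
    bvTensorMap (𝟙 P) (𝟙 Q) = 𝟙 (bvTensor P Q) := by
  refine Operad.hom_ext rfl fun n p => ?_
  induction p using Quotient.inductionOn with | h p => ?_
  refine congrArg (Quotient.mk _) (Subtype.ext ?_)
  obtain ⟨t, ht⟩ := p
  change BVTerm.map (𝟙 P) (𝟙 Q) t = t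
  clear ht
  induction t with
  | left p d => rfl
  | right c q => rfl
  | unit x => rfl
  | comp p q e ihp ihq => simp only [BVTerm.map, ihp, ihq]

theorem bvTensorMap_comp {P P' P'' Q Q' Q'' : Operad} (f : P ⟶ P') (f' : P' ⟶ P'')
    (g : Q ⟶ Q') (g' : Q' ⟶ Q'') :
    bvTensorMap (f ≫ f') (g ≫ g') = bvTensorMap f g ≫ bvTensorMap f' g' := by
  refine Operad.hom_ext rfl fun n p => ?_
  induction p using Quotient.inductionOn with | h p => ?_
  refine congrArg (Quotient.mk _) (Subtype.ext ?_)
  obtain ⟨t, ht⟩ := p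
  change BVTerm.map (f ≫ f') (g ≫ g') t = BVTerm.map f' g' (BVTerm.map f g t)
  clear ht
  induction t with
  | left p d => rfl
  | right c q => rfl
  | unit x => rfl
  | comp p q e ihp ihq => simp only [BVTerm.map, ihp, ihq]

/-! ## Trees -/

/-- Finite rooted trees. A tree is either the trivial tree `η`, consisting of a single edge, or it
has a root vertex with `n ≥ 0` inputs, with a tree grafted onto each input. (The numbering of the
inputs is only a device for writing down trees: morphisms of trees do not have to respect it.)
A top edge is a leaf if it comes from `eta`, and a stump if it comes from `node 0 _`. -/
inductive RTree : Type
  | eta : RTree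
  | node (n : ℕ) (t : Fin n → RTree) : RTree

namespace RTree

/-- The edges of a tree. In `node n t`, the root edge is `none`, and `some ⟨i, e⟩` is the edge `e`
of the `i`-th subtree. -/
def Edge : RTree → Type
  | eta => Unit
  | node _ t => Option (Σ i, Edge (t i))

/-- The vertices of a tree. In `node n t`, the root vertex is `none`. -/
def Vertex : RTree → Type
  | eta => Empty
  | node _ t => Option (Σ i, Vertex (t i))

/-- The root edge. -/
def root : ∀ T : RTree, T.Edge
  | eta => ()
  | node _ _ => none

/-- The number of input edges of a vertex. -/
def arity : ∀ T : RTree, T.Vertex → ℕ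
  | eta, v => v.elim
  | node n _, none => n
  | node _ t, some ⟨i, v⟩ => arity (t i) v

/-- The input edges of a vertex. -/
def input : ∀ (T : RTree) (v : T.Vertex), Fin (T.arity v) → T.Edge
  | eta, v => v.elim
  | node _ t, none => fun i => some ⟨i, root (t i)⟩
  | node _ t, some ⟨i, v⟩ => fun j => some ⟨i, input (t i) v j⟩

/-- The output edge of a vertex. -/
def output : ∀ (T : RTree), T.Vertex → T.Edge
  | eta, v => v.elim
  | node _ _, none => none
  | node _ t, some ⟨i, v⟩ => some ⟨i, output (t i) v⟩

/-- The size of a tree: the number of non-root edges plus the number of vertices. -/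
noncomputable def size (T : RTree) : ℕ :=
  Nat.card {e : T.Edge // e ≠ T.root} + Nat.card T.Vertex

/-- `T.HasOp c d` says that `(c₁, …, cₙ; d)` is obtained from the vertices of `T` and the units by
operadic composition; equivalently, that `T` has a subtree with root `d` whose leaves are
`c₁, …, cₙ` (each listed once). -/
inductive HasOp (T : RTree) : ∀ {n : ℕ}, (Fin n → T.Edge) → T.Edge → Prop
  | unit (e : T.Edge) : HasOp T (fun _ : Fin 1 => e) e
  | graft (v : T.Vertex) {k : Fin (T.arity v) → ℕ} {m : ℕ} (b : ∀ i, Fin (k i) → T.Edge)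
      (e : (Σ i, Fin (k i)) ≃ Fin m) (c : Fin m → T.Edge) :
      (∀ i, HasOp T (b i) (T.input v i)) → (∀ i j, c (e ⟨i, j⟩) = b i j) →
      HasOp T c (T.output v)

namespace HasOp

variable {T : RTree}

theorem relabel {n m : ℕ} {c : Fin n → T.Edge} {d : T.Edge} (h : HasOp T c d)
    (s : Fin n ≃ Fin m) (c' : Fin m → T.Edge) (hc : ∀ i, c' (s i) = c i) : HasOp T c' d := by
  cases h with
  | unit =>
    obtain rfl : 1 = m := by simpa using Fintype.card_congr s
    have : c' = fun _ => d := by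
      funext x
      obtain ⟨i, rfl⟩ := s.surjective x
      exact hc i
    rw [this]
    exact .unit d
  | graft v b e _ hb hcb => exact .graft v b (e.trans s) c' hb fun i j => by simp [hc, hcb]

theorem comp {m : ℕ} {c : Fin m → T.Edge} {d : T.Edge} (h : HasOp T c d) :
    ∀ {N : ℕ} {l : Fin m → ℕ} (a : ∀ x, Fin (l x) → T.Edge) (e' : (Σ x, Fin (l x)) ≃ Fin N)
      (z : Fin N → T.Edge), (∀ x, HasOp T (a x) (c x)) → (∀ x y, z (e' ⟨x, y⟩) = a x y) →
      HasOp T z d := by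
  induction h with
  | unit d =>
    intro N l a e' z ha hz
    exact (ha 0).relabel ((Equiv.uniqueSigma fun x => Fin (l x)).symm.trans e') z
      fun i => by simpa using hz 0 i
  | graft v b e c hb hc ih =>
    intro N l a e' z ha hz
    let f := fun i => finSigmaFinEquiv (m := _) (n := fun j => l (e ⟨i, j⟩))
    let f' := ((Equiv.sigmaCongrRight f).symm.trans
      ((Equiv.sigmaAssoc fun i j => Fin (l (e ⟨i, j⟩))).symm.trans
        (Equiv.sigmaCongrLeft (β := fun x => Fin (l x)) e))).trans e'
    have hf' : ∀ i j y, f' ⟨i, f i ⟨j, y⟩⟩ = e' ⟨e ⟨i, j⟩, y⟩ := by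
      intro i j y
      simp [f', Equiv.sigmaCongrLeft, Equiv.sigmaCongrRight, Equiv.sigmaAssoc]
    refine .graft v (fun i x => z (f' ⟨i, x⟩)) f' z (fun i => ?_) fun _ _ => rfl
    refine ih i (fun j => a (e ⟨i, j⟩)) (f i) _ (fun j => ?_) fun j y => ?_
    · rw [← hc]
      exact ha _
    · rw [hf', hz]

end HasOp

theorem sigma_symm_apply {A B : Type} {n : ℕ} {k : Fin n → ℕ} (b : ∀ i, Fin (k i) → A)
    (e : (Σ i, Fin (k i)) ≃ B) (z : Σ i, Fin (k i)) :
    b (e.symm (e z)).1 (e.symm (e z)).2 = b z.1 z.2 := by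
  rw [Equiv.symm_apply_apply]

/-- The coloured symmetric operad `Ω(T)` generated by a tree `T`: its colours are the edges
of `T`, and it is freely generated by the vertices of `T`. In this free operad an operation is
determined by its inputs and its output, so its set of operations from `c₁, …, cₙ` to `d` has
exactly one element if `T.HasOp c d`, and is empty otherwise. -/
def operad (T : RTree) : Operad where
  Col := T.Edge
  Op n := {p : (Fin n → T.Edge) × T.Edge // T.HasOp p.1 p.2}
  src p := p.1.1
  tgt p := p.1.2
  unit e := ⟨(fun _ => e, e), .unit e⟩
  comp p q h e :=
    ⟨(fun x => (q (e.symm x).1).1.1 (e.symm x).2, p.1.2),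
      p.2.comp (fun i => (q i).1.1) e _ (fun i => by rw [← h i]; exact (q i).2)
        fun i j => sigma_symm_apply (fun i => (q i).1.1) e ⟨i, j⟩⟩
  src_unit _ _ := rfl
  tgt_unit _ := rfl
  src_comp p q h e i j := sigma_symm_apply (fun i => (q i).1.1) e ⟨i, j⟩
  tgt_comp _ _ _ _ := rfl
  unit_comp p e he := by
    refine Subtype.ext (Prod.ext (funext fun x => ?_) rfl)
    obtain ⟨⟨i, j⟩, rfl⟩ := e.surjective x
    obtain rfl : i = 0 := Subsingleton.elim _ _
    refine (sigma_symm_apply (fun _ => p.1.1) e ⟨0, j⟩).trans ?_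
    rw [he]
  comp_unit p e he := by
    refine Subtype.ext (Prod.ext (funext fun x => ?_) rfl)
    obtain ⟨⟨i, j⟩, rfl⟩ := e.surjective x
    obtain rfl : j = 0 := Subsingleton.elim _ _
    refine (sigma_symm_apply (fun i _ => p.1.1 i) e ⟨i, 0⟩).trans ?_
    rw [he]
  assoc p q h e r h' e' f f' hf := by
    refine Subtype.ext (Prod.ext (funext fun x => ?_) rfl)
    obtain ⟨⟨x, y⟩, rfl⟩ := e'.surjective x
    obtain ⟨⟨i, j⟩, rfl⟩ := e.surjective x
    refine (sigma_symm_apply (fun x => (r x).1.1) e' ⟨e ⟨i, j⟩, y⟩).trans ?_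
    rw [hf]
    refine Eq.symm ((sigma_symm_apply (fun i x =>
      (r (e ⟨i, ((f i).symm x).1⟩)).1.1 ((f i).symm x).2) f' ⟨i, f i ⟨j, y⟩⟩).trans ?_)
    exact sigma_symm_apply (fun j => (r (e ⟨i, j⟩)).1.1) (f i) ⟨j, y⟩

/-- The category `Ω` of trees: a morphism `S ⟶ T` is a map of operads `Ω(S) ⟶ Ω(T)`. -/
instance : SmallCategory RTree where
  Hom S T := S.operad ⟶ T.operad
  id T := 𝟙 T.operad
  comp f g := CategoryStruct.comp (obj := Operad) f g
  id_comp f := Category.id_comp (obj := Operad) f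
  comp_id f := Category.comp_id (obj := Operad) f
  assoc f g h := Category.assoc (obj := Operad) f g h

/-- The fully faithful functor `T ↦ Ω(T)` from trees to operads. -/
def toOperad : RTree ⥤ Operad where
  obj := operad
  map f := f

/-! ## Linear trees -/

/-- The linear tree with `n` vertices and one leaf. -/
def linear : ℕ → RTree
  | 0 => eta
  | n + 1 => node 1 fun _ => linear n

/-- The edges of the linear tree, numbered `0, …, n` from the leaf to the root. -/
def linearEdge : ∀ n : ℕ, (linear n).Edge ≃ Fin (n + 1)
  | 0 => ⟨fun _ => 0, fun _ => (), fun _ => rfl, fun _ => Subsingleton.elim (α := Fin 1) _ _⟩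
  | n + 1 =>
    ((Equiv.optionCongr ((Equiv.uniqueSigma fun _ : Fin 1 => (linear n).Edge).trans
      (linearEdge n))).trans finSuccEquivLast.symm :
        Option (Σ _ : Fin 1, (linear n).Edge) ≃ Fin (n + 1 + 1))

theorem linearEdge_none (n : ℕ) :
    linearEdge (n + 1) (none : Option (Σ _ : Fin 1, (linear n).Edge)) = Fin.last (n + 1) := rfl

theorem linearEdge_some (n : ℕ) (i : Fin 1) (e : (linear n).Edge) :
    linearEdge (n + 1) (some ⟨i, e⟩ : Option (Σ _ : Fin 1, (linear n).Edge)) =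
      (linearEdge n e).castSucc := by
  obtain rfl : i = 0 := Subsingleton.elim _ _
  exact finSuccEquivLast_symm_some _

theorem linear_arity : ∀ (n : ℕ) (v : (linear n).Vertex), (linear n).arity v = 1
  | 0, v => v.elim
  | _ + 1, none => rfl
  | n + 1, some ⟨_, v⟩ => linear_arity n v

theorem linear_input_le : ∀ (n : ℕ) (v : (linear n).Vertex) (i : Fin ((linear n).arity v)),
    linearEdge n ((linear n).input v i) ≤ linearEdge n ((linear n).output v)
  | 0, v, _ => v.elim
  | _ + 1, none, _ => Fin.le_last _
  | n + 1, some ⟨x, v⟩, i => by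
    have := linear_input_le n v i
    refine (linearEdge_some n x _).trans_le (le_trans ?_ (linearEdge_some n x _).ge)
    exact Fin.castSucc_le_castSucc_iff.2 this

theorem HasOp.lift {n : ℕ} (t : Fin n → RTree) (i : Fin n) {m : ℕ} {c : Fin m → (t i).Edge}
    {d : (t i).Edge} (h : HasOp (t i) c d) :
    HasOp (node n t) (fun x => some ⟨i, c x⟩) (some ⟨i, d⟩) := by
  induction h with
  | unit e => exact .unit _
  | graft v b e c hb hc ih =>
    exact HasOp.graft (T := node n t) (some ⟨i, v⟩) (fun x y => some ⟨i, b x y⟩) e _ ih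
      fun x y => congrArg (fun a => (some ⟨i, a⟩ : Option (Σ i, (t i).Edge))) (hc x y)

theorem linear_root : ∀ n : ℕ, linearEdge n (linear n).root = Fin.last n
  | 0 => rfl
  | _ + 1 => rfl

theorem linear_hasOp_of_le : ∀ (n : ℕ) (c d : (linear n).Edge),
    linearEdge n c ≤ linearEdge n d → HasOp (linear n) (fun _ : Fin 1 => c) d
  | 0, _, d, _ => .unit d
  | n + 1, c, none, _ => by
    rcases c with _ | ⟨i, c⟩
    · exact .unit _
    · have := linear_hasOp_of_le n c (linear n).root (by rw [linear_root]; exact Fin.le_last _)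
      exact HasOp.graft (T := node 1 fun _ => linear n) none (k := fun _ => 1)
        (fun _ _ => some ⟨i, c⟩) (Equiv.uniqueSigma fun _ : Fin 1 => Fin 1) _
        (fun j => by
          obtain rfl : i = j := Subsingleton.elim _ _
          exact HasOp.lift (fun _ : Fin 1 => linear n) i this)
        fun _ _ => rfl
  | n + 1, none, some ⟨i, d⟩, h => by
    have h' := (linearEdge_none n).ge.trans (h.trans (linearEdge_some n i d).le)
    exact absurd h' (Fin.castSucc_lt_last _).not_ge
  | n + 1, some ⟨i, c⟩, some ⟨j, d⟩, h => by
    obtain rfl : i = j := Subsingleton.elim _ _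
    have h' := (linearEdge_some n i c).ge.trans (h.trans (linearEdge_some n i d).le)
    exact HasOp.lift (fun _ : Fin 1 => linear n) i
      (linear_hasOp_of_le n c d (Fin.castSucc_le_castSucc_iff.1 h'))

theorem linear_hasOp_iff (n : ℕ) {m : ℕ} (c : Fin m → (linear n).Edge) (d : (linear n).Edge) :
    HasOp (linear n) c d ↔ m = 1 ∧ ∀ i, linearEdge n (c i) ≤ linearEdge n d := by
  constructor
  · intro h
    induction h with
    | unit e => exact ⟨rfl, fun _ => le_rfl⟩
    | graft v b e c hb hc ih =>
      refine ⟨?_, fun x => ?_⟩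
      · have := Fintype.card_congr e
        simpa [(ih _).1, linear_arity] using this.symm
      · obtain ⟨⟨i, j⟩, rfl⟩ := e.surjective x
        rw [hc]
        exact ((ih i).2 j).trans (linear_input_le n v i)
  · rintro ⟨rfl, h⟩
    have : c = fun _ => c 0 := funext fun i => congrArg c (Subsingleton.elim _ _)
    rw [this]
    exact linear_hasOp_of_le n _ _ (h 0)

/-- The map of linear trees given by a monotone map. -/
def linearMap {m n : ℕ} (f : Fin (m + 1) →o Fin (n + 1)) : linear m ⟶ linear n where
  onCol e := (linearEdge n).symm (f (linearEdge m e))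
  onOp p := ⟨(fun i => (linearEdge n).symm (f (linearEdge m (p.1.1 i))),
    (linearEdge n).symm (f (linearEdge m p.1.2))), by
      have := (linear_hasOp_iff m _ _).1 p.2
      exact (linear_hasOp_iff n _ _).2 ⟨this.1, fun i => by simpa using f.monotone (this.2 i)⟩⟩
  src_onOp _ _ := rfl
  tgt_onOp _ := rfl
  onOp_unit _ := rfl
  onOp_comp _ _ _ _ := rfl

/-- The inclusion `i : Δ ⥤ Ω`, sending `[n]` to the linear tree with edges `0, …, n`. -/
def ofSimplex : SimplexCategory ⥤ RTree where
  obj n := linear n.len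
  map f := linearMap f.toOrderHom
  map_id n := by
    refine Operad.hom_ext (funext fun e => ?_) fun k p => Subtype.ext (Prod.ext ?_ ?_)
    · exact (linearEdge _).symm_apply_apply e
    · exact funext fun i => (linearEdge _).symm_apply_apply _
    · exact (linearEdge _).symm_apply_apply _
  map_comp f g := by
    have key : ∀ e, (linearMap (SimplexCategory.Hom.toOrderHom (f ≫ g))).onCol e =
        (linearMap g.toOrderHom).onCol ((linearMap f.toOrderHom).onCol e) := by
      intro e
      simp only [linearMap, Equiv.apply_symm_apply]
      rfl
    exact Operad.hom_ext (funext key) fun k p =>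
      Subtype.ext (Prod.ext (funext fun i => key _) (key _))

end RTree

/-! ## Dendroidal sets -/

/-- Dendroidal sets: presheaves of sets on the category of trees. -/
abbrev DSet : Type 1 := RTreeᵒᵖ ⥤ Type

/-- The dendroidal nerve of an operad, `N(P)_T = Hom(Ω(T), P)`. -/
def nerve : Operad ⥤ DSet :=
  yoneda ⋙ (Functor.whiskeringLeft _ _ _).obj RTree.toOperad.op

namespace DSet

/-- Representatives of elements of `(X ⊗ Y)_R`: an element `x` of `X_S`, an element `y` of `Y_T`,
and an element of `N(Ω(S) ⊗ Ω(T))_R`, where `Ω(S) ⊗ Ω(T)` is the Boardman–Vogt tensor product. -/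
structure TensorRep (X Y : DSet) (R : RTree) : Type where
  S : RTree
  T : RTree
  x : X.obj (op S)
  y : Y.obj (op T)
  z : (nerve.obj (bvTensor S.operad T.operad)).obj (op R)

/-- The generating identifications between such representatives. -/
inductive TensorRel (X Y : DSet) (R : RTree) : TensorRep X Y R → TensorRep X Y R → Prop
  | mk {S S' T T' : RTree} (f : S ⟶ S') (g : T ⟶ T') (x : X.obj (op S')) (y : Y.obj (op T'))
      (z : (nerve.obj (bvTensor S.operad T.operad)).obj (op R)) :
      TensorRel X Y R ⟨S, T, X.map f.op x, Y.map g.op y, z⟩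
        ⟨S', T', x, y,
          (nerve.map (bvTensorMap (RTree.toOperad.map f) (RTree.toOperad.map g))).app (op R) z⟩

/-- The tensor product of dendroidal sets: the extension of
`Ω[S] ⊗ Ω[T] = N(Ω(S) ⊗ Ω(T))` to all dendroidal sets that preserves colimits in both variables,
given by the coend formula `X ⊗ Y = ∫^{S, T} X_S × Y_T × N(Ω(S) ⊗ Ω(T))`. -/
noncomputable def tensor (X Y : DSet) : DSet where
  obj R := Quot (TensorRel X Y R.unop)
  map {R R'} f := TypeCat.ofHom (Quot.map
    (fun t => ⟨t.S, t.T, t.x, t.y, (nerve.obj (bvTensor t.S.operad t.T.operad)).map f t.z⟩) (by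
      rintro _ _ ⟨u, v, x, y, z⟩
      exact TensorRel.mk u v x y ((nerve.obj _).map f z)))
  map_id R := by
    ext t
    induction t using Quot.inductionOn with | h t => ?_
    rfl
  map_comp f g := by
    ext t
    induction t using Quot.inductionOn with | h t => ?_
    rfl

/-- The tensor product of maps of dendroidal sets. -/
noncomputable def tensorMap {X X' Y Y' : DSet} (f : X ⟶ X') (g : Y ⟶ Y') : tensor X Y ⟶ tensor X' Y' where
  app R := TypeCat.ofHom (Quot.map
    (fun t => ⟨t.S, t.T, f.app _ t.x, g.app _ t.y, t.z⟩) (by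
      rintro _ _ ⟨u, v, x, y, z⟩
      have hf : f.app _ (X.map u.op x) = X'.map u.op (f.app _ x) := NatTrans.naturality_apply f u.op x
      have hg : g.app _ (Y.map v.op y) = Y'.map v.op (g.app _ y) := NatTrans.naturality_apply g v.op y
      dsimp only
      rw [hf, hg]
      exact TensorRel.mk u v _ _ z))
  naturality R R' u := by
    ext t
    induction t using Quot.inductionOn with | h t => ?_
    rfl

theorem tensorMap_id (X Y : DSet) : tensorMap (𝟙 X) (𝟙 Y) = 𝟙 (tensor X Y) := by
  ext R t
  induction t using Quot.inductionOn with | h t => ?_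
  rfl

theorem tensorMap_comp {X X' X'' Y Y' Y'' : DSet} (f : X ⟶ X') (f' : X' ⟶ X'')
    (g : Y ⟶ Y') (g' : Y' ⟶ Y'') :
    tensorMap (f ≫ f') (g ≫ g') = tensorMap f g ≫ tensorMap f' g' := by
  ext R t
  induction t using Quot.inductionOn with | h t => ?_
  rfl

/-- The internal hom `Y^X` of dendroidal sets, right adjoint to the tensor product:
`(Y^X)_T = Hom(X ⊗ Ω[T], Y)`. -/
noncomputable def ihom (X Y : DSet) : DSet where
  obj T := tensor X (yoneda.obj T.unop) ⟶ Y
  map f := TypeCat.ofHom fun h => tensorMap (𝟙 X) (yoneda.map f.unop) ≫ h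
  map_id T := by
    refine ConcreteCategory.hom_ext _ _ fun h => ?_
    simp [tensorMap_id]
  map_comp f g := by
    refine ConcreteCategory.hom_ext _ _ fun h => ?_
    have := tensorMap_comp (𝟙 X) (𝟙 X) (yoneda.map g.unop) (yoneda.map f.unop)
    rw [Category.comp_id] at this
    simp [this]

/-- The functor `i_!` from simplicial sets to dendroidal sets, left adjoint to the restriction
along `i : Δ ⥤ Ω`. -/
noncomputable def ofSSet : SSet.{0} ⥤ DSet :=
  RTree.ofSimplex.op.lan

/-- The functor `i^*` from dendroidal sets to simplicial sets, restriction along `i : Δ ⥤ Ω`. -/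
def toSSet : DSet ⥤ SSet.{0} :=
  (Functor.whiskeringLeft _ _ _).obj RTree.ofSimplex.op

/-- The cotensor `Y^M = Y^{i_! M}` of a dendroidal set `Y` by a simplicial set `M`. -/
noncomputable def cotensor (Y : DSet) (M : SSet.{0}) : DSet :=
  ihom (ofSSet.obj M) Y

/-- The simplicial hom `sHom(X, Y) = i^*(Y^X)`. -/
noncomputable def sHom (X Y : DSet) : SSet.{0} :=
  toSSet.obj (ihom X Y)

/-! ## Lean dendroidal sets and lean simplicial sets -/

/-- The full subcategory of `Ω` on the trees of size at most `n`. -/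
abbrev Trunc (n : ℕ) : Type :=
  ObjectProperty.FullSubcategory (fun T : RTree => T.size ≤ n)

/-- The inclusion of the trees of size at most `n` into all trees. -/
abbrev truncInclusion (n : ℕ) : Trunc n ⥤ RTree :=
  ObjectProperty.ι _

/-- The canonical map `X ⟶ cosk_n X`, where `cosk_n X` is the right Kan extension of the restriction
of `X` to trees of size at most `n`: the unit of the adjunction between restriction and right Kan
extension. -/
noncomputable def toCosk (n : ℕ) (X : DSet) :
    X ⟶ (truncInclusion n).op.ran.obj ((truncInclusion n).op ⋙ X) :=
  ((truncInclusion n).op.ranAdjunction Type).unit.app X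

/-- A dendroidal set is degreewise finite if all its values are finite sets. -/
def DegreewiseFinite (X : DSet) : Prop :=
  ∀ T : RTree, Finite (X.obj (op T))

/-- A dendroidal set is lean if it is degreewise finite and coskeletal, that is,
`X ⟶ cosk_n X` is an isomorphism for some `n`. -/
def IsLeanDSet (X : DSet) : Prop :=
  DegreewiseFinite X ∧ ∃ n : ℕ, IsIso (toCosk n X)

end DSet

/-- A simplicial set is degreewise finite if all its sets of simplices are finite. -/
def SSetDegreewiseFinite (M : SSet.{0}) : Prop :=
  ∀ n : SimplexCategory, Finite (M.obj (op n))

/-- A simplicial set is lean if it is degreewise finite and `n`-coskeletal for some `n`, that is,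
`M ⟶ cosk_n M` is an isomorphism. -/
def IsLeanSSet (M : SSet.{0}) : Prop :=
  SSetDegreewiseFinite M ∧ ∃ n : ℕ, IsIso ((SimplicialObject.coskAdj n).unit.app M)

end Dendroidal

/-! Everything rests on replacing the Boardman–Vogt tensor product by a cartesian product whenever
one factor is linear. In `Ω[k] ⊗ Ω(T)` the interchange relation moves each arrow of `[k]` from below
an operation of `T` to its inputs. Every operation is therefore an operation of `T` with arrows of
`[k]` on its inputs, and is determined by its input and output colours: the operad is thin. Hence a
map `Ω(R) → Ω[k] ⊗ Ω(T)` is a pair of a map `R → T` and a labelling of the edges of `R` in `[k]`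
that increases weakly towards the root (`linearTensorHom_bijective`, `tensorLinearHom_bijective`).

Write `L_k` for the presheaf of labellings in `[k]`, and `L(M)` for the coend of `M_k × L_k`. Then
`X ⊗ Ω[k] ≅ X × L_k`, so `sHom(X, Y)_k = Hom(X × L_k, Y)`. Likewise `i_! M ⊗ Ω[T]` and `L(M) × Ω[T]`
have the same maps to every `Y`, so `Y^M` is the cartesian exponential of `Y` by `L(M)`.

Let `Y` be `n`-coskeletal. A map into `Y` is determined by, and can be constructed from, its values
on trees of size at most `n`. There are finitely many such trees, so `Hom(W, Y)` is finite when `W`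
and `Y` are degreewise finite; this gives degreewise finiteness of both constructions.

Coskeletality holds with the same `n`. For `Y^M` it is the general fact that exponentials into a
coskeletal presheaf are coskeletal. For `sHom(X, Y)` the point is that a tree `R` has at most `|R| +
1` edges, so a labelling of `R` factors through a simplex of dimension at most `|R|`; for `|R| ≤ n`,
the simplices of dimension at most `n` suffice. The same factorization makes `L(M)` degreewise
finite. -/

namespace Dendroidal

/-! ### Coskeletal presheaves, finiteness of maps into them, and exponentials -/

section Coskeletal

variable {C : Type} [SmallCategory C]

/-- A presheaf `X` is coskeletal with respect to the objects satisfying `P` if every compatible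
family of elements of `X`, indexed by the maps `R ⟶ T` with `P R`, comes from exactly one element of
`X` at `T`. -/
def IsCoskeletal (P : ObjectProperty C) (X : Cᵒᵖ ⥤ Type) : Prop :=
  ∀ (T : C) (s : ∀ R : C, P R → (R ⟶ T) → X.obj (op R)),
    (∀ (R R' : C) (hR : P R) (hR' : P R') (g : R' ⟶ R) (f : R ⟶ T),
      X.map g.op (s R hR f) = s R' hR' (g ≫ f)) →
    ∃! x : X.obj (op T), ∀ (R : C) (hR : P R) (f : R ⟶ T), X.map f.op x = s R hR f

variable {P : ObjectProperty C} {X Y W : Cᵒᵖ ⥤ Type}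

theorem presheaf_hom_ext {φ ψ : W ⟶ Y}
    (h : ∀ (R : C) (w : W.obj (op R)), φ.app (op R) w = ψ.app (op R) w) : φ = ψ :=
  NatTrans.ext (funext fun R => ConcreteCategory.hom_ext _ _ fun w => h R.unop w)

/-- A map of presheaves given by functions on elements. -/
def presheafHom (φ : ∀ R : C, W.obj (op R) → Y.obj (op R))
    (h : ∀ (R R' : C) (g : R' ⟶ R) (w : W.obj (op R)),
      φ R' (W.map g.op w) = Y.map g.op (φ R w)) : W ⟶ Y where
  app R := TypeCat.ofHom (φ R.unop)
  naturality _ _ g := ConcreteCategory.hom_ext _ _ fun w => h _ _ g.unop w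

/-- By naturality, the images of `w` under `φ` and `ψ` both solve the extension problem given by the
restrictions of `w`, and its solution is unique. -/
theorem IsCoskeletal.hom_ext (hY : IsCoskeletal P Y) {φ ψ : W ⟶ Y}
    (h : ∀ (R : C) (_ : P R) (w : W.obj (op R)), φ.app (op R) w = ψ.app (op R) w) : φ = ψ := by
  refine presheaf_hom_ext fun T w => ?_
  refine (hY T (fun R _ f => φ.app (op R) (W.map f.op w)) ?_).unique ?_ ?_
  · intro R R' hR hR' g f
    rw [← NatTrans.naturality_apply, op_comp, Functor.map_comp_apply]
  · intro R hR f
    rw [← NatTrans.naturality_apply]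
  · intro R hR f
    rw [h R hR, ← NatTrans.naturality_apply]

/-- A natural map into a coskeletal presheaf may be constructed on the objects satisfying `P`. -/
theorem IsCoskeletal.exists_hom (hY : IsCoskeletal P Y)
    (ψ : ∀ R : C, P R → W.obj (op R) → Y.obj (op R))
    (hψ : ∀ (R R' : C) (hR : P R) (hR' : P R') (g : R' ⟶ R) (w : W.obj (op R)),
      ψ R' hR' (W.map g.op w) = Y.map g.op (ψ R hR w)) :
    ∃ φ : W ⟶ Y, ∀ (R : C) (hR : P R) (w : W.obj (op R)), φ.app (op R) w = ψ R hR w := by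
  have key : ∀ (T : C) (w : W.obj (op T)), ∃! y : Y.obj (op T),
      ∀ (R : C) (hR : P R) (f : R ⟶ T), Y.map f.op y = ψ R hR (W.map f.op w) := by
    intro T w
    refine hY T (fun R hR f => ψ R hR (W.map f.op w)) ?_
    intro R R' hR hR' g f
    rw [← hψ R R' hR hR', op_comp, Functor.map_comp_apply]
  choose y hy hy' using fun T w => (key T w)
  refine ⟨presheafHom y ?_, ?_⟩
  · intro T T' g w
    refine (hy' T' (W.map g.op w) (Y.map g.op (y T w)) ?_).symm
    intro R hR f
    have := hy T w R hR (f ≫ g)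
    rw [op_comp, Functor.map_comp_apply, Functor.map_comp_apply] at this
    exact this
  · intro R hR w
    have : y R w = ψ R hR w := by simpa using hy R w R hR (𝟙 R)
    exact this

/-- Under the adjunction, restricting `f : W ⟶ X` corresponds to composing `f` with the unit. So the
unit is invertible exactly when maps of restrictions extend uniquely, and representable `W` already
test this. Allowing an arbitrary right adjoint `G` covers the dendroidal and the simplicial
coskeleton at once. -/
theorem isIso_unit_app_iff {G : (P.FullSubcategoryᵒᵖ ⥤ Type) ⥤ (Cᵒᵖ ⥤ Type)}
    (adj : (Functor.whiskeringLeft _ _ Type).obj P.ι.op ⊣ G) :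
    IsIso (adj.unit.app X) ↔ IsCoskeletal P X := by
  have key : ∀ {W : Cᵒᵖ ⥤ Type} (f : W ⟶ X), adj.homEquiv _ _
      (((Functor.whiskeringLeft _ _ Type).obj P.ι.op).map f) = f ≫ adj.unit.app X := by
    intro W f
    rw [Adjunction.homEquiv_unit]
    exact (adj.unit.naturality f).symm
  constructor
  · intro h T s hs
    -- A compatible family is the same as a map from the restricted representable presheaf of `T`.
    let σ : ((Functor.whiskeringLeft _ _ Type).obj P.ι.op).obj (yoneda.obj T) ⟶
        ((Functor.whiskeringLeft _ _ Type).obj P.ι.op).obj X :=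
      { app := fun R => TypeCat.ofHom fun f => s R.unop.1 R.unop.2 f
        naturality := by
          intro R R' g
          ext f
          exact (hs _ _ R.unop.2 R'.unop.2 g.unop.hom f).symm }
    obtain ⟨φ, hφ⟩ : ∃ φ : yoneda.obj T ⟶ X,
        ((Functor.whiskeringLeft _ _ Type).obj P.ι.op).map φ = σ := by
      refine ⟨adj.homEquiv _ _ σ ≫ inv (adj.unit.app X), (adj.homEquiv _ _).injective ?_⟩
      rw [key, Category.assoc, IsIso.inv_hom_id, Category.comp_id]
    refine ⟨yonedaEquiv φ, ?_, ?_⟩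
    · intro R hR f
      have := ConcreteCategory.congr_hom (congr_app hφ (op ⟨R, hR⟩)) f
      refine Eq.trans ?_ this
      refine (NatTrans.naturality_apply φ f.op (𝟙 T)).symm.trans ?_
      exact congrArg (φ.app (op R)) (Category.comp_id f)
    · intro x hx
      rw [← Equiv.symm_apply_eq]
      rw [← cancel_mono (adj.unit.app X), ← key, ← key]
      congr 1
      rw [hφ]
      ext R f
      exact hx _ R.unop.2 f
  · intro h
    have : ∀ (W : Cᵒᵖ ⥤ Type) (σ : ((Functor.whiskeringLeft _ _ Type).obj P.ι.op).obj W ⟶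
        ((Functor.whiskeringLeft _ _ Type).obj P.ι.op).obj X), ∃ φ : W ⟶ X,
        ((Functor.whiskeringLeft _ _ Type).obj P.ι.op).map φ = σ := by
      intro W σ
      obtain ⟨φ, hφ⟩ := h.exists_hom (W := W) (fun R hR w => σ.app (op ⟨R, hR⟩) w) (by
        intro R R' hR hR' g w
        exact NatTrans.naturality_apply σ
          (Quiver.Hom.op (⟨g⟩ : (⟨R', hR'⟩ : P.FullSubcategory) ⟶ ⟨R, hR⟩)) w)
      refine ⟨φ, ?_⟩
      ext R w
      exact hφ _ R.unop.2 w
    -- The inverse of the unit is the extension of the counit to all objects; the two triangle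
    -- identities give the two composites.
    obtain ⟨φ, hφ⟩ := this _ (adj.counit.app (((Functor.whiskeringLeft _ _ Type).obj P.ι.op).obj X))
    refine ⟨φ, ?_, ?_⟩
    · refine h.hom_ext fun R hR w => ?_
      have h1 := adj.left_triangle_components X
      rw [← hφ] at h1
      exact ConcreteCategory.congr_hom (congr_app h1 (op ⟨R, hR⟩)) w
    · rw [← key, hφ, adj.homEquiv_unit]
      exact adj.right_triangle_components _

theorem IsCoskeletal.of_iso (h : IsCoskeletal P X) (e : X ≅ Y) : IsCoskeletal P Y := by
  intro T s hs
  obtain ⟨x, hx, hx'⟩ := h T (fun R hR f => e.inv.app _ (s R hR f)) (by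
    intro R R' hR hR' g f
    rw [← NatTrans.naturality_apply, hs R R' hR hR'])
  refine ⟨e.hom.app _ x, ?_, ?_⟩
  · intro R hR f
    rw [← NatTrans.naturality_apply, hx R hR]
    simp
  · intro y hy
    have := hx' (e.inv.app _ y) (by
      intro R hR f
      rw [← NatTrans.naturality_apply, hy])
    rw [← this]
    simp

/-- By `IsCoskeletal.hom_ext`, a map is recorded faithfully by finitely many functions between
finite sets. -/
theorem IsCoskeletal.finite_hom [Finite P.FullSubcategory] (hY : IsCoskeletal P Y)
    (hW : ∀ R, P R → Finite (W.obj (op R))) (hY' : ∀ R, P R → Finite (Y.obj (op R))) :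
    Finite (W ⟶ Y) := by
  have (R : P.FullSubcategory) : Finite (W.obj (op R.1)) := hW _ R.2
  have (R : P.FullSubcategory) : Finite (Y.obj (op R.1)) := hY' _ R.2
  refine Finite.of_injective
    (fun φ (R : P.FullSubcategory) (w : W.obj (op R.1)) => φ.app (op R.1) w) ?_
  intro φ ψ h
  exact hY.hom_ext fun R hR w => congrFun (congrFun h ⟨R, hR⟩) w

/-- The presheaf `R ↦ A_R × Hom(R, T)`. -/
abbrev prodYoneda (A : Cᵒᵖ ⥤ Type) (T : C) : Cᵒᵖ ⥤ Type :=
  FunctorToTypes.prod A (yoneda.obj T)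

/-- The element of `A_R × Hom(R, T)` with given components. -/
def prodYonedaMk {A : Cᵒᵖ ⥤ Type} {R T : C} (a : A.obj (op R)) (f : R ⟶ T) :
    (prodYoneda A T).obj (op R) := (a, f)

theorem prodYoneda_hom_ext {A : Cᵒᵖ ⥤ Type} {T : C} {φ ψ : prodYoneda A T ⟶ Y}
    (h : ∀ (R : C) (a : A.obj (op R)) (f : R ⟶ T),
      φ.app (op R) (prodYonedaMk a f) = ψ.app (op R) (prodYonedaMk a f)) : φ = ψ :=
  presheaf_hom_ext fun R w => h R w.1 w.2

theorem prodYoneda_naturality {A : Cᵒᵖ ⥤ Type} {R R' T : C} (φ : prodYoneda A T ⟶ Y)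
    (a : A.obj (op R)) (f : R ⟶ T) (g : R' ⟶ R) :
    φ.app (op R') (prodYonedaMk (A.map g.op a) (g ≫ f)) =
      Y.map g.op (φ.app (op R) (prodYonedaMk a f)) :=
  NatTrans.naturality_apply φ g.op (prodYonedaMk a f)

/-- The map `A_R × Hom(R, T) → A_R × Hom(R, T')` induced by a map `T ⟶ T'`. -/
def prodYonedaMap (A : Cᵒᵖ ⥤ Type) {T T' : C} (f : T ⟶ T') : prodYoneda A T ⟶ prodYoneda A T' :=
  presheafHom (fun _ w => prodYonedaMk w.1 (w.2 ≫ f)) fun _ _ g w =>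
    congrArg (prodYonedaMk (A.map g.op w.1)) (Category.assoc _ _ _)

/-- The presheaf `T ↦ Hom(A × Hom(-, T), Y)`, the exponential of `Y` by `A` for the cartesian
product of presheaves. -/
def exponential (A Y : Cᵒᵖ ⥤ Type) : Cᵒᵖ ⥤ Type where
  obj T := prodYoneda A T.unop ⟶ Y
  map f := TypeCat.ofHom fun φ => prodYonedaMap A f.unop ≫ φ
  map_id _ := ConcreteCategory.hom_ext _ _ fun φ => prodYoneda_hom_ext fun R a f =>
    congrArg (φ.app (op R)) (congrArg (prodYonedaMk a) (Category.comp_id f))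
  map_comp g h := ConcreteCategory.hom_ext _ _ fun φ => prodYoneda_hom_ext fun R a f =>
    congrArg (φ.app (op R)) (congrArg (prodYonedaMk a) (Category.assoc f h.unop g.unop).symm)

theorem exponential_map_app {A : Cᵒᵖ ⥤ Type} {R T T' : C} (f : T ⟶ T')
    (φ : prodYoneda A T' ⟶ Y) (a : A.obj (op R)) (g : R ⟶ T) :
    NatTrans.app ((exponential A Y).map f.op φ : prodYoneda A T ⟶ Y) (op R) (prodYonedaMk a g) =
      φ.app (op R) (prodYonedaMk a (g ≫ f)) := rfl

/-- Naturality forces the glued map to send `(a, f)` to the value of `s R hR f` at `(a, 𝟙 R)`. This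
is prescribed only for `R` satisfying `P`, which is enough because the target `Y` is coskeletal;
nothing is needed of `A`. -/
theorem IsCoskeletal.exponential (hY : IsCoskeletal P Y) (A : Cᵒᵖ ⥤ Type) :
    IsCoskeletal P (exponential A Y) := by
  intro T (s : ∀ R : C, P R → (R ⟶ T) → (prodYoneda A R ⟶ Y)) hs
  have hs' : ∀ (R R' : C) (hR : P R) (hR' : P R') (g : R' ⟶ R) (f : R ⟶ T) (Q : C)
      (a : A.obj (op Q)) (u : Q ⟶ R'),
      (s R hR f).app (op Q) (prodYonedaMk a (u ≫ g)) =
        (s R' hR' (g ≫ f)).app (op Q) (prodYonedaMk a u) := by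
    intro R R' hR hR' g f Q a u
    rw [← hs R R' hR hR' g f]
    rfl
  obtain ⟨φ, hφ⟩ := hY.exists_hom (W := prodYoneda A T)
    (fun R hR w => (s R hR w.2).app (op R) (prodYonedaMk w.1 (𝟙 R))) (by
      rintro R R' hR hR' g ⟨a, f⟩
      rw [← prodYoneda_naturality, Category.comp_id]
      refine (hs' R R' hR hR' g f R' (A.map g.op a) (𝟙 R')).symm.trans ?_
      rw [Category.id_comp])
  have hφ' : ∀ (R : C) (hR : P R) (a : A.obj (op R)) (f : R ⟶ T),
      φ.app (op R) (prodYonedaMk a f) = (s R hR f).app (op R) (prodYonedaMk a (𝟙 R)) :=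
    fun R hR a f => hφ R hR (prodYonedaMk a f)
  refine ⟨φ, ?_, ?_⟩
  · intro R hR f
    refine hY.hom_ext ?_
    rintro Q hQ ⟨a, g⟩
    refine (hφ' Q hQ a (g ≫ f)).trans ?_
    rw [← hs' R Q hR hQ, Category.id_comp]
    rfl
  · intro (φ' : prodYoneda A T ⟶ Y) h'
    refine hY.hom_ext ?_
    rintro R hR ⟨a, f⟩
    refine Eq.trans ?_ (hφ' R hR a f).symm
    rw [← h' R hR f, exponential_map_app, Category.id_comp]
    rfl

end Coskeletal

/-! ### Finiteness of the set of trees of bounded size -/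

namespace RTree

instance finite_edge : ∀ T : RTree, Finite T.Edge
  | eta => inferInstanceAs (Finite Unit)
  | node n t =>
    have := fun i => finite_edge (t i)
    inferInstanceAs (Finite (Option (Σ i : Fin n, (t i).Edge)))

instance finite_vertex : ∀ T : RTree, Finite T.Vertex
  | eta => inferInstanceAs (Finite Empty)
  | node n t =>
    have := fun i => finite_vertex (t i)
    inferInstanceAs (Finite (Option (Σ i : Fin n, (t i).Vertex)))

theorem card_edge_le (T : RTree) : Nat.card T.Edge ≤ T.size + 1 := by
  classical
  have e : Option {e : T.Edge // e ≠ T.root} ≃ T.Edge := Equiv.optionSubtypeNe T.root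
  rw [← Nat.card_congr e, Finite.card_option, size]
  omega

theorem arity_le_size (n : ℕ) (t : Fin n → RTree) : n ≤ (node n t).size := by
  have h : Nat.card (Fin n) ≤ Nat.card {e : (node n t).Edge // e ≠ (node n t).root} :=
    Nat.card_le_card_of_injective
      (fun i => ⟨(some ⟨i, (t i).root⟩ : Option (Σ i, (t i).Edge)), fun h => by cases h⟩)
      fun i j h => by
        have := congrArg Subtype.val h
        exact congrArg Sigma.fst (Option.some.inj this)
  rw [Nat.card_fin] at h
  rw [size]
  omega

theorem size_lt_size_node (n : ℕ) (t : Fin n → RTree) (i : Fin n) :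
    (t i).size < (node n t).size := by
  have h : Nat.card {e : (t i).Edge // e ≠ (t i).root} ≤
      Nat.card {e : (node n t).Edge // e ≠ (node n t).root} :=
    Nat.card_le_card_of_injective
      (fun e => ⟨(some ⟨i, e.1⟩ : Option (Σ i, (t i).Edge)), fun h => by cases h⟩)
      fun e e' h => by
        have := Option.some.inj (congrArg Subtype.val h)
        exact Subtype.ext (eq_of_heq (Sigma.mk.inj this).2)
  have h' : Nat.card (Option (t i).Vertex) ≤ Nat.card (node n t).Vertex :=
    Nat.card_le_card_of_injective
      (fun v => (v.map fun v => ⟨i, v⟩ : Option (Σ i, (t i).Vertex)))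
      (Option.map_injective fun _ _ h => eq_of_heq (Sigma.mk.inj h).2)
  rw [Finite.card_option] at h'
  rw [size, size]
  omega

/-- A tree other than `eta` is given by the arity of its root vertex, which is at most the size, and
by the subtrees above it, which have smaller size. -/
theorem finite_setOf_size_le (N : ℕ) : {T : RTree | T.size ≤ N}.Finite := by
  induction N with
  | zero =>
    refine (Set.finite_singleton eta).subset ?_
    rintro (_ | ⟨n, t⟩) h
    · rfl
    · have : 0 < (node n t).size := by
        have : 0 < Nat.card (node n t).Vertex :=
          Nat.card_pos_iff.2 ⟨⟨(none : Option (Σ i, (t i).Vertex))⟩, inferInstance⟩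
        rw [size]
        omega
      exact absurd h this.not_ge
  | succ N ih =>
    have : Finite {T : RTree | T.size ≤ N} := ih
    refine (((Set.finite_singleton eta).union (Set.finite_range
      fun x : Σ n : Fin (N + 2), Fin n → {T : RTree | T.size ≤ N} =>
        node x.1 fun i => (x.2 i).1))).subset ?_
    rintro (_ | ⟨n, t⟩) h
    · exact Or.inl rfl
    · refine Or.inr ⟨⟨⟨n, ?_⟩, fun i => ⟨t i, ?_⟩⟩, rfl⟩
      · exact Nat.lt_succ_of_le ((arity_le_size n t).trans h)
      · exact Nat.le_of_lt_succ ((size_lt_size_node n t i).trans_le h)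

instance finite_trunc (N : ℕ) : Finite (DSet.Trunc N) :=
  have : Finite {T : RTree | T.size ≤ N} := finite_setOf_size_le N
  Finite.of_injective (fun T => (⟨T.1, T.2⟩ : {T : RTree | T.size ≤ N}))
    fun _ _ h => ObjectProperty.FullSubcategory.ext (congrArg Subtype.val h)

end RTree

/-! ## Operads whose operations are determined by their inputs and output -/

/-- An operad is thin if its operations are determined by their inputs and their output. -/
def Operad.IsThin (P : Operad) : Prop :=
  ∀ (n : ℕ) (p q : P.Op n), P.src p = P.src q → P.tgt p = P.tgt q → p = q

namespace Operad.IsThin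

variable {P Q : Operad}

theorem hom_ext (hQ : Q.IsThin) {f g : P ⟶ Q} (h : f.onCol = g.onCol) : f = g := by
  refine Operad.hom_ext h fun n p => hQ n _ _ (funext fun i => ?_) ?_
  · rw [f.src_onOp, g.src_onOp, h]
  · rw [f.tgt_onOp, g.tgt_onOp, h]

/-- A map into a thin operad is a map of colours that is compatible with the operations. -/
theorem exists_hom (hQ : Q.IsThin) (f : P.Col → Q.Col)
    (hf : ∀ (n : ℕ) (p : P.Op n), ∃ q : Q.Op n, Q.src q = f ∘ P.src p ∧ Q.tgt q = f (P.tgt p)) :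
    ∃ g : P ⟶ Q, g.onCol = f := by
  choose φ hφ hφ' using hf
  refine ⟨{ onCol := f, onOp := fun {n} p => φ n p, src_onOp := fun p i => congrFun (hφ _ p) i,
            tgt_onOp := fun p => hφ' _ p, onOp_unit := ?_, onOp_comp := ?_ }, rfl⟩
  · intro c
    refine hQ _ _ _ (funext fun i => ?_) ?_
    · rw [hφ, Function.comp_apply, P.src_unit, Q.src_unit]
    · rw [hφ', P.tgt_unit, Q.tgt_unit]
  · intro n m k p q h e
    refine hQ _ _ _ (funext fun x => ?_) ?_
    · obtain ⟨⟨i, j⟩, rfl⟩ := e.surjective x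
      rw [Q.src_comp, hφ, hφ, Function.comp_apply, P.src_comp, Function.comp_apply]
    · rw [Q.tgt_comp, hφ', hφ', P.tgt_comp]

end Operad.IsThin

theorem RTree.isThin_operad (T : RTree) : T.operad.IsThin := fun _ _ _ h h' =>
  Subtype.ext (Prod.ext h h')

instance RTree.finite_hom (R T : RTree) : Finite (R ⟶ T) :=
  Finite.of_injective (β := R.Edge → T.Edge) (fun f : R ⟶ T => f.onCol)
    fun _ _ h => T.isThin_operad.hom_ext h

/-! ## The tensor product of a linear tree and a tree -/

namespace BVTerm

open RTree

/-- The bijection that reorders the inputs of the composite with a unary operation at the root. -/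
def rootEquiv (n : ℕ) : (Σ _ : Fin 1, Fin n) ≃ Fin n where
  toFun z := z.2
  invFun j := ⟨0, j⟩
  left_inv _ := Sigma.ext (Subsingleton.elim _ _) HEq.rfl
  right_inv _ := rfl

/-- The bijection that reorders the inputs of the composite with unary operations at the inputs. -/
def topEquiv (n : ℕ) : (Σ _ : Fin n, Fin 1) ≃ Fin n where
  toFun z := z.1
  invFun j := ⟨j, 0⟩
  left_inv _ := Sigma.ext rfl (heq_of_eq (Subsingleton.elim _ _))
  right_inv _ := rfl

section Linear

variable {k : ℕ} {T : RTree}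

/-- The unique operation from an edge `a` of the linear tree to an edge `b` below it. -/
def arrow (a b : (linear k).Edge) (h : linearEdge k a ≤ linearEdge k b) : (linear k).operad.Op 1 :=
  ⟨(fun _ => a, b), linear_hasOp_of_le k a b h⟩

theorem eq_arrow (p : (linear k).operad.Op 1) :
    ∃ h, p = arrow ((linear k).operad.src p 0) ((linear k).operad.tgt p) h := by
  refine ⟨((linear_hasOp_iff k _ _).1 p.2).2 0, ?_⟩
  refine (linear k).isThin_operad _ _ _ (funext fun i => ?_) rfl
  obtain rfl : i = 0 := Subsingleton.elim _ _
  rfl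

/-- The formal composite of an operation of `T` and operations of the linear tree at its inputs. -/
def normalForm {n : ℕ} (c : Fin n → (linear k).Edge × T.Edge) (b : (linear k).Edge) (d : T.Edge)
    (hT : T.HasOp (fun i => (c i).2) d) (h : ∀ i, linearEdge k (c i).1 ≤ linearEdge k b) :
    BVTerm (linear k).operad T.operad n :=
  comp (right b (⟨(fun i => (c i).2, d), hT⟩ : T.operad.Op n))
    (fun i => left (arrow (c i).1 b (h i)) (c i).2) (topEquiv n)

theorem left_arrow_congr {x y : (linear k).Edge × T.Edge} (e : x = y) (b : (linear k).Edge)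
    (h : linearEdge k x.1 ≤ linearEdge k b) (h' : linearEdge k y.1 ≤ linearEdge k b) :
    (left (arrow x.1 b h) x.2 : BVTerm (linear k).operad T.operad 1) =
      left (arrow y.1 b h') y.2 := by
  subst e
  rfl

/-- A composite with a formal composite of operations of `T`, and operations of the linear tree at
its inputs. -/
theorem rel_normalForm {n : ℕ} (t : BVTerm (linear k).operad T.operad n) (ht : WF t)
    (b : (linear k).Edge) (hb : linearEdge k (tgt t).1 ≤ linearEdge k b) :
    ∃ hT h, Rel (comp (left (arrow (tgt t).1 b hb) (tgt t).2) (fun _ => t) (rootEquiv n))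
      (normalForm (src t) b (tgt t).2 hT h) := by
  -- The extra arrow from the output of `t` to an arbitrary `b` makes the induction work: in a
  -- composite, the arrows that emerge at the inputs of `p` must be pushed through the `q i`, with
  -- the same `b` throughout.
  induction t generalizing b with
  | @left n u d =>
    obtain rfl : n = 1 := ((linear_hasOp_iff k _ _).1 u.2).1
    obtain ⟨hu, hu'⟩ := eq_arrow u
    refine ⟨.unit _, fun i => ?_, ?_⟩
    · obtain rfl : i = 0 := Subsingleton.elim _ _
      exact hu.trans hb
    · refine (Rel.left_comp (Q := T.operad) (arrow _ b hb) (fun _ => u) (fun _ => rfl)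
        (rootEquiv 1) d).symm.trans ?_
      -- The two arrows compose to one; a unit of `T` is then inserted below it to reach the shape
      -- of `normalForm`.
      have := Rel.unit_comp (P := (linear k).operad) (Q := T.operad)
        (left ((linear k).operad.comp (arrow _ b hb) (fun _ => u) (fun _ => rfl) (rootEquiv 1)) d)
        (topEquiv 1) (fun _ => Subsingleton.elim _ _)
      refine this.symm.trans (Rel.congr _ ?_ fun i => ?_)
      · exact (Rel.right_unit (P := (linear k).operad) (Q := T.operad) b d).symm
      · have : (linear k).operad.comp (arrow _ b hb) (fun _ => u) (fun _ => rfl) (rootEquiv 1) =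
            arrow ((linear k).operad.src u i) b (by
              obtain rfl : i = 0 := Subsingleton.elim _ _
              exact hu.trans hb) := by
          refine (linear k).isThin_operad _ _ _ (funext fun j => ?_) rfl
          refine ((linear k).operad.src_comp (arrow _ b hb) (fun _ => u) (fun _ => rfl)
            (rootEquiv 1) 0 j).trans ?_
          rw [Subsingleton.elim j i]
          rfl
        rw [this]
        exact .refl _
  | right c q =>
    -- With a unary operation on the linear side, the interchange relation is precisely the passage
    -- to normal form.
    exact ⟨q.2, fun _ => hb, Rel.interchange (arrow c b hb) q _ _ fun _ _ => rfl⟩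
  | unit x =>
    refine ⟨.unit x.2, fun _ => hb, ?_⟩
    refine (Rel.comp_unit (left (arrow x.1 b hb) x.2) (rootEquiv 1)
      fun _ => Subsingleton.elim _ _).trans ?_
    refine (Rel.unit_comp (left (arrow x.1 b hb) x.2) (topEquiv 1)
      fun _ => Subsingleton.elim _ _).symm.trans (Rel.congr _ ?_ fun _ => .refl _)
    exact (Rel.right_unit (P := (linear k).operad) (Q := T.operad) b x.2).symm
  | @comp n m l p q e ihp ihq =>
    obtain ⟨hp, hq, hpq⟩ := ht
    obtain ⟨hT, h, hr⟩ := ihp hp b hb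
    have h' : ∀ i, linearEdge k (tgt (q i)).1 ≤ linearEdge k b := fun i => by
      rw [hpq i]
      exact h i
    choose hT' hh hr' using fun i => ihq i (hq i) b (h' i)
    have hsrc : ∀ i j, src (comp p q e) (e ⟨i, j⟩) = src (q i) j :=
      fun i j => src_comp_apply p q e ⟨i, j⟩
    have hle : ∀ x, linearEdge k (src (comp p q e) x).1 ≤ linearEdge k b := fun x => by
      obtain ⟨⟨i, j⟩, rfl⟩ := e.surjective x
      rw [hsrc]
      exact hh i j
    have hop : T.HasOp (fun x => (src (comp p q e) x).2) (tgt p).2 := by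
      refine hT.comp (fun i j => (src (q i) j).2) e _ (fun i => ?_) fun i j => ?_
      · rw [← hpq i]
        exact hT' i
      · rw [hsrc]
    refine ⟨hop, hle, ?_⟩
    let u : T.operad.Op n := ⟨(fun i => (src p i).2, (tgt p).2), hT⟩
    let v : ∀ i, T.operad.Op (l i) := fun i => ⟨(fun j => (src (q i) j).2, (tgt (q i)).2), hT' i⟩
    have huv : ∀ i, T.operad.tgt (v i) = T.operad.src u i := fun i => congrArg Prod.snd (hpq i)
    have huv' : T.operad.comp u v huv e =
        (⟨(fun x => (src (comp p q e) x).2, (tgt p).2), hop⟩ : T.operad.Op m) := by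
      refine T.isThin_operad _ _ _ (funext fun x => ?_) rfl
      obtain ⟨⟨i, j⟩, rfl⟩ := e.surjective x
      refine (T.operad.src_comp u v huv e i j).trans ?_
      exact congrArg Prod.snd (hsrc i j).symm
    -- Reassociate so that the arrow meets `p`, push it to the inputs of `p`, and reassociate again
    -- so that the resulting arrows meet the `q i`. After pushing these through, the operations of
    -- `T` are adjacent, and `Rel.right_comp` merges them into one.
    refine (Rel.assoc _ (fun _ => p) (rootEquiv n) q e (fun _ => e) (rootEquiv m)
      fun _ _ _ => rfl).symm.trans ?_
    refine (Rel.congr e hr fun i => .refl _).trans ?_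
    refine (Rel.assoc _ _ (topEquiv n) q e (fun i => rootEquiv (l i)) e fun _ _ _ => rfl).trans ?_
    have h1 : ∀ i, Rel (comp (left (arrow (src p i).1 b (h i)) (src p i).2) (fun _ => q i)
        (rootEquiv (l i))) (comp (right b (v i)) (fun j =>
          left (arrow (src (comp p q e) (e ⟨i, j⟩)).1 b (hle _)) (src (comp p q e) (e ⟨i, j⟩)).2)
          (topEquiv (l i))) := by
      intro i
      have h2 := hr' i
      rw [left_arrow_congr (hpq i) b _ (h i)] at h2
      refine h2.trans (Rel.congr _ (.refl _) fun j => ?_)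
      rw [left_arrow_congr (hsrc i j) b _ (hh i j)]
      exact .refl _
    refine (Rel.congr e (.refl _) h1).trans ?_
    refine (Rel.assoc (right b u) (fun i => right b (v i)) e
      (fun x => left (arrow (src (comp p q e) x).1 b (hle x)) (src (comp p q e) x).2) (topEquiv m)
      (fun i => topEquiv (l i)) e fun _ _ _ => rfl).symm.trans ?_
    refine Rel.congr _ ?_ fun _ => .refl _
    refine (Rel.right_comp (P := (linear k).operad) b u v huv e).symm.trans ?_
    rw [huv']
    exact .refl _

/-- Insert a unit, viewed as an identity arrow of the linear tree, below `t` and push it through. -/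
theorem exists_rel_normalForm {n : ℕ} (t : BVTerm (linear k).operad T.operad n) (ht : WF t) :
    ∃ hT h, Rel t (normalForm (src t) (tgt t).1 (tgt t).2 hT h) := by
  obtain ⟨hT, h, hr⟩ := rel_normalForm t ht (tgt t).1 le_rfl
  refine ⟨hT, h, (Rel.unit_comp t (rootEquiv n) fun _ => rfl).symm.trans (Rel.trans ?_ hr)⟩
  exact Rel.congr _ (Rel.left_unit (P := (linear k).operad) (Q := T.operad) _ _).symm
    fun _ => .refl _

/-- The normal form depends only on the input and output colours. This is the source of thinness. -/
theorem rel_of_src_eq_of_tgt_eq {n : ℕ} {s t : BVTerm (linear k).operad T.operad n}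
    (hs : WF s) (ht : WF t) (h : src s = src t) (h' : tgt s = tgt t) : Rel s t := by
  obtain ⟨hT, hle, hr⟩ := exists_rel_normalForm s hs
  obtain ⟨hT', hle', hr'⟩ := exists_rel_normalForm t ht
  refine hr.trans (Rel.trans ?_ hr'.symm)
  simp only [h, h']
  exact .refl _

end Linear

/-! ### Symmetry of the Boardman–Vogt tensor product, to exchange the two factors -/

section Swap

variable {P Q : Operad}

/-- The symmetry `P ⊗ Q ≅ Q ⊗ P` on formal composites. -/
def swap : ∀ {n : ℕ}, BVTerm P Q n → BVTerm Q P n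
  | _, left p d => right d p
  | _, right c q => left q c
  | _, unit x => unit x.swap
  | _, comp p q e => comp (swap p) (fun i => swap (q i)) e

theorem swap_swap {n : ℕ} (t : BVTerm P Q n) : swap (swap t) = t := by
  induction t with
  | left p d => rfl
  | right c q => rfl
  | unit x => rfl
  | comp p q e ihp ihq => simp only [swap, ihp, ihq]

theorem src_swap {n : ℕ} (t : BVTerm P Q n) : ∀ i, src (swap t) i = (src t i).swap := by
  induction t with
  | left p d => exact fun _ => rfl
  | right c q => exact fun _ => rfl
  | unit x => exact fun _ => rfl
  | comp p q e ihp ihq => exact fun i => ihq _ _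

theorem tgt_swap {n : ℕ} (t : BVTerm P Q n) : tgt (swap t) = (tgt t).swap := by
  induction t with
  | left p d => rfl
  | right c q => rfl
  | unit x => rfl
  | comp p q e ihp ihq => exact ihp

theorem WF.swap {n : ℕ} {t : BVTerm P Q n} (h : WF t) : WF (swap t) := by
  induction t with
  | left p d => trivial
  | right c q => trivial
  | unit x => trivial
  | comp p q e ihp ihq =>
    exact ⟨ihp h.1, fun i => ihq i (h.2.1 i), fun i => by rw [tgt_swap, src_swap, h.2.2]⟩

theorem Rel.swap {n : ℕ} {s t : BVTerm P Q n} (h : Rel s t) : Rel (swap s) (swap t) := by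
  induction h with
  | refl => exact .refl _
  | symm _ ih => exact .symm ih
  | trans _ _ ih ih' => exact .trans ih ih'
  | congr e _ _ ih ih' => exact .congr e ih ih'
  | unit_comp p e he =>
    have := Rel.unit_comp (BVTerm.swap p) e he
    rwa [tgt_swap] at this
  | comp_unit p e he =>
    have := Rel.comp_unit (BVTerm.swap p) e he
    simp only [src_swap] at this
    exact this
  | assoc p q e r e' u u' hu => exact .assoc _ _ _ _ _ _ _ hu
  | left_unit c d => exact .right_unit _ _
  | left_comp p q h e d => exact .right_comp _ _ _ _ _
  | right_unit c d => exact .left_unit _ _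
  | right_comp c p q h e => exact .left_comp _ _ _ _ _
  | interchange p q e e' he => exact .symm (.interchange q p e' e fun i j => (he j i).symm)

end Swap

end BVTerm

open BVTerm

/-- The operad `Ω[k] ⊗ Ω(T)` for the linear tree with `k` vertices is thin. -/
theorem isThin_bvTensor_linear (k : ℕ) (T : RTree) :
    (bvTensor (RTree.linear k).operad T.operad).IsThin := by
  intro n p q h h'
  induction p using Quotient.inductionOn with | h p => ?_
  induction q using Quotient.inductionOn with | h q => ?_
  exact Quotient.sound (rel_of_src_eq_of_tgt_eq p.2 q.2 h h')

theorem isThin_bvTensor_linear' (T : RTree) (k : ℕ) :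
    (bvTensor T.operad (RTree.linear k).operad).IsThin := by
  intro n p q h h'
  induction p using Quotient.inductionOn with | h p => ?_
  induction q using Quotient.inductionOn with | h q => ?_
  have h : src p.1 = src q.1 := h
  have h' : tgt p.1 = tgt q.1 := h'
  refine Quotient.sound ?_
  have := (rel_of_src_eq_of_tgt_eq p.2.swap q.2.swap
    (funext fun i => by rw [src_swap, src_swap, h]) (by rw [tgt_swap, tgt_swap, h'])).swap
  rwa [swap_swap, swap_swap] at this

/-- An operation of `Ω[k] ⊗ Ω(T)` with given inputs and output exists if and only if there is one
in `Ω(T)` and the colours of the inputs in the linear tree are at most that of the output. -/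
theorem exists_op_bvTensor_linear_iff {k : ℕ} {T : RTree} {n : ℕ}
    (c : Fin n → (RTree.linear k).Edge × T.Edge) (d : (RTree.linear k).Edge × T.Edge) :
    (∃ p : (bvTensor (RTree.linear k).operad T.operad).Op n,
      (bvTensor (RTree.linear k).operad T.operad).src p = c ∧
        (bvTensor (RTree.linear k).operad T.operad).tgt p = d) ↔
      T.HasOp (fun i => (c i).2) d.2 ∧
        ∀ i, RTree.linearEdge k (c i).1 ≤ RTree.linearEdge k d.1 := by
  constructor
  · rintro ⟨p, rfl, rfl⟩
    induction p using Quotient.inductionOn with | h p => ?_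
    obtain ⟨hT, h, -⟩ := exists_rel_normalForm p.1 p.2
    exact ⟨hT, h⟩
  · rintro ⟨hT, h⟩
    refine ⟨Quotient.mk _ ⟨normalForm c d.1 d.2 hT h, trivial, fun _ => trivial, fun _ => rfl⟩,
      ?_, rfl⟩
    funext x
    obtain ⟨⟨i, j⟩, rfl⟩ := (topEquiv n).surjective x
    exact src_comp_apply _ _ (topEquiv n) ⟨i, j⟩

theorem exists_op_bvTensor_linear_iff' {k : ℕ} {T : RTree} {n : ℕ}
    (c : Fin n → T.Edge × (RTree.linear k).Edge) (d : T.Edge × (RTree.linear k).Edge) :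
    (∃ p : (bvTensor T.operad (RTree.linear k).operad).Op n,
      (bvTensor T.operad (RTree.linear k).operad).src p = c ∧
        (bvTensor T.operad (RTree.linear k).operad).tgt p = d) ↔
      T.HasOp (fun i => (c i).1) d.1 ∧
        ∀ i, RTree.linearEdge k (c i).2 ≤ RTree.linearEdge k d.2 := by
  refine Iff.trans ?_ (exists_op_bvTensor_linear_iff (fun i => (c i).swap) d.swap)
  constructor
  · rintro ⟨p, rfl, rfl⟩
    induction p using Quotient.inductionOn with | h p => ?_
    exact ⟨Quotient.mk _ ⟨swap p.1, p.2.swap⟩, funext fun i => src_swap p.1 i, tgt_swap p.1⟩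
  · rintro ⟨p, h, h'⟩
    induction p using Quotient.inductionOn with | h p => ?_
    refine ⟨Quotient.mk _ ⟨swap p.1, p.2.swap⟩, funext fun i => (src_swap p.1 i).trans ?_,
      (tgt_swap p.1).trans ?_⟩
    · exact congrArg Prod.swap (congrFun h i)
    · exact congrArg Prod.swap h'

/-! ## Monotone labellings of the edges of a tree -/

/-- The labellings of the edges of `R` by elements of `[k]` such that the label of an input of an
operation is at most the label of its output. -/
def Labelling (k : SimplexCategory) (R : RTree) : Type :=
  {a : R.Edge → Fin (k.len + 1) //
    ∀ (n : ℕ) (c : Fin n → R.Edge) (d : R.Edge), R.HasOp c d → ∀ i, a (c i) ≤ a d}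

namespace Labelling

variable {k l : SimplexCategory} {R R' : RTree}

instance : Finite (Labelling k R) :=
  inferInstanceAs (Finite {a : R.Edge → Fin (k.len + 1) //
    ∀ (n : ℕ) (c : Fin n → R.Edge) (d : R.Edge), R.HasOp c d → ∀ i, a (c i) ≤ a d})

/-- The labelling obtained by applying a monotone map to the labels. -/
def push (a : Labelling k R) (u : k ⟶ l) : Labelling l R :=
  ⟨fun e => u.toOrderHom (a.1 e), fun n c d h i => u.toOrderHom.monotone (a.2 n c d h i)⟩

/-- The labelling pulled back along a map of trees. -/
def pull (a : Labelling k R) (g : R' ⟶ R) : Labelling k R' :=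
  ⟨fun e => a.1 (g.onCol e), fun n c d h i => by
    have h1 := g.src_onOp (⟨(c, d), h⟩ : R'.operad.Op n) i
    have h2 := g.tgt_onOp (⟨(c, d), h⟩ : R'.operad.Op n)
    have h3 := a.2 n _ _ (g.onOp (⟨(c, d), h⟩ : R'.operad.Op n)).2 i
    exact (congrArg a.1 h1).ge.trans (h3.trans (congrArg a.1 h2).le)⟩

/-- A labelling takes at most as many values as there are edges, so it is determined by a labelling
in a small simplex. -/
theorem exists_factorization (a : Labelling k R) :
    ∃ (l : SimplexCategory) (u : l ⟶ k) (r : k ⟶ l), l.len ≤ R.size ∧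
      (∀ y, ∃ e, u.toOrderHom y = a.1 e) ∧ (a.push r).push u = a := by
  classical
  have := Fintype.ofFinite R.Edge
  let s : Finset (Fin (k.len + 1)) := Finset.univ.image a.1
  have hs : s.Nonempty := ⟨a.1 R.root, Finset.mem_image_of_mem _ (Finset.mem_univ _)⟩
  -- The set of labels used is nonempty, so as an ordered set it is `[i]` for this `i`.
  obtain ⟨i, hi⟩ : ∃ i, s.card = i + 1 := ⟨s.card - 1, by have := hs.card_pos; omega⟩
  -- The root edge is not counted in the size, so there are at most `R.size + 1` labels; the shift
  -- in `i` absorbs the extra one.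
  have hi' : i ≤ R.size := by
    have h1 : s.card ≤ Nat.card R.Edge := by
      rw [Nat.card_eq_fintype_card]
      exact Finset.card_image_le
    have h2 := R.card_edge_le
    omega
  let u := s.orderEmbOfFin hi
  -- A monotone retraction of `u`: count the used labels below `y`. The minimum with `i` matters
  -- only when `y` lies above all of them.
  let r : Fin (k.len + 1) →o Fin (i + 1) :=
    ⟨fun y => ⟨min (Finset.univ.filter fun j => u j < y).card i, by omega⟩, fun y y' h => by
      refine min_le_min_right i (Finset.card_le_card fun j hj => ?_)
      rw [Finset.mem_filter] at hj ⊢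
      exact ⟨hj.1, hj.2.trans_le h⟩⟩
  have hr : ∀ j, r (u j) = j := by
    intro j
    refine Fin.ext ?_
    have : (Finset.univ.filter fun j' => u j' < u j) = Finset.Iio j := by
      ext j'
      simp
    change min (Finset.univ.filter fun j' => u j' < u j).card i = j
    rw [this, Fin.card_Iio]
    omega
  have hmem : ∀ y, ∃ e, u y = a.1 e := fun y => by
    have := s.orderEmbOfFin_mem hi y
    obtain ⟨e, -, he⟩ := Finset.mem_image.1 this
    exact ⟨e, he.symm⟩
  refine ⟨SimplexCategory.mk i, SimplexCategory.Hom.mk u.toOrderHom, SimplexCategory.Hom.mk r, hi',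
    hmem, Subtype.ext (funext fun e => ?_)⟩
  have : a.1 e ∈ Set.range u := by
    rw [Finset.range_orderEmbOfFin]
    exact Finset.mem_image_of_mem _ (Finset.mem_univ _)
  obtain ⟨y, hy⟩ := this
  change u (r (a.1 e)) = a.1 e
  rw [← hy, hr]

end Labelling

/-- The dendroidal set of labellings in `[k]`, as a functor of `[k]`. -/
def labellings : SimplexCategory ⥤ DSet where
  obj k :=
    { obj := fun R => Labelling k R.unop
      map := fun g => TypeCat.ofHom fun a => a.pull g.unop }
  map u := { app := fun R => TypeCat.ofHom fun a => a.push u }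

/-! ## The nerve of the tensor product with a linear tree -/

section PairHom

open RTree

variable {R R' T T' : RTree} {k l : SimplexCategory}

/-- By thinness only the colours must be given, and an operation on them exists as soon as it exists
in `T` and the labels increase weakly towards the output. -/
theorem exists_linearTensorHom (a : Labelling k R) (h : R ⟶ T) :
    ∃ z : R.operad ⟶ bvTensor (ofSimplex.obj k).operad T.operad,
      z.onCol = fun e => ((linearEdge k.len).symm (a.1 e), h.onCol e) := by
  refine (isThin_bvTensor_linear k.len T).exists_hom _ fun n p =>
    (exists_op_bvTensor_linear_iff _ _).2 ⟨?_, fun i => ?_⟩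
  · have h1 := funext (h.src_onOp p)
    have h2 := h.tgt_onOp p
    have h3 := (h.onOp p).2
    change T.HasOp (T.operad.src (h.onOp p)) (T.operad.tgt (h.onOp p)) at h3
    rw [h1, h2] at h3
    exact h3
  · exact ((linearEdge k.len).apply_symm_apply _).le.trans
      ((a.2 n _ _ p.2 i).trans ((linearEdge k.len).apply_symm_apply _).ge)

/-- The map `Ω(R) ⟶ Ω[k] ⊗ Ω(T)` given by a labelling and a map of trees. -/
noncomputable def linearTensorHom (a : Labelling k R) (h : R ⟶ T) :
    R.operad ⟶ bvTensor (ofSimplex.obj k).operad T.operad :=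
  (exists_linearTensorHom a h).choose

theorem onCol_linearTensorHom (a : Labelling k R) (h : R ⟶ T) :
    (linearTensorHom a h).onCol = fun e => ((linearEdge k.len).symm (a.1 e), h.onCol e) :=
  (exists_linearTensorHom a h).choose_spec

theorem exists_tensorLinearHom (h : R ⟶ T) (a : Labelling k R) :
    ∃ z : R.operad ⟶ bvTensor T.operad (ofSimplex.obj k).operad,
      z.onCol = fun e => (h.onCol e, (linearEdge k.len).symm (a.1 e)) := by
  refine (isThin_bvTensor_linear' T k.len).exists_hom _ fun n p =>
    (exists_op_bvTensor_linear_iff' _ _).2 ⟨?_, fun i => ?_⟩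
  · have h1 := funext (h.src_onOp p)
    have h2 := h.tgt_onOp p
    have h3 := (h.onOp p).2
    change T.HasOp (T.operad.src (h.onOp p)) (T.operad.tgt (h.onOp p)) at h3
    rw [h1, h2] at h3
    exact h3
  · exact ((linearEdge k.len).apply_symm_apply _).le.trans
      ((a.2 n _ _ p.2 i).trans ((linearEdge k.len).apply_symm_apply _).ge)

/-- The map `Ω(R) ⟶ Ω(T) ⊗ Ω[k]` given by a map of trees and a labelling. -/
noncomputable def tensorLinearHom (h : R ⟶ T) (a : Labelling k R) :
    R.operad ⟶ bvTensor T.operad (ofSimplex.obj k).operad :=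
  (exists_tensorLinearHom h a).choose

theorem onCol_tensorLinearHom (h : R ⟶ T) (a : Labelling k R) :
    (tensorLinearHom h a).onCol = fun e => (h.onCol e, (linearEdge k.len).symm (a.1 e)) :=
  (exists_tensorLinearHom h a).choose_spec

theorem exists_op_of_hom {P Q : Operad} (z : P ⟶ Q) {n : ℕ} (p : P.Op n) :
    ∃ q : Q.Op n, Q.src q = (fun i => z.onCol (P.src p i)) ∧ Q.tgt q = z.onCol (P.tgt p) :=
  ⟨z.onOp p, funext (z.src_onOp p), z.tgt_onOp p⟩

/-- Both sides are determined by their effect on edges. Conversely, the two coordinates of a map on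
colours satisfy separately the conditions for a labelling and for a map of trees. -/
theorem linearTensorHom_bijective :
    Function.Bijective fun w : Labelling k R × (R ⟶ T) => linearTensorHom w.1 w.2 := by
  constructor
  · rintro ⟨a, h⟩ ⟨a', h'⟩ e
    have := congrArg Operad.Hom.onCol e
    simp only [onCol_linearTensorHom] at this
    refine Prod.ext (Subtype.ext (funext fun e => ?_)) (T.isThin_operad.hom_ext (funext fun e => ?_))
    · exact (linearEdge k.len).symm.injective (congrArg Prod.fst (congrFun this e))
    · exact congrArg Prod.snd (congrFun this e)
  · intro z
    have hz := fun (n : ℕ) (p : R.operad.Op n) =>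
      (exists_op_bvTensor_linear_iff _ _).1 (exists_op_of_hom z p)
    obtain ⟨h, hh⟩ := T.isThin_operad.exists_hom (P := R.operad) (fun e => (z.onCol e).2)
      fun n p => ⟨⟨(fun i => (z.onCol (R.operad.src p i)).2, (z.onCol (R.operad.tgt p)).2),
        (hz n p).1⟩, rfl, rfl⟩
    refine ⟨(⟨fun e => linearEdge k.len (z.onCol e).1,
      fun n c d hcd => (hz n ⟨(c, d), hcd⟩).2⟩, h), ?_⟩
    refine (isThin_bvTensor_linear k.len T).hom_ext ?_
    refine (onCol_linearTensorHom _ _).trans (funext fun e => Prod.ext ?_ ?_)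
    · exact (linearEdge k.len).symm_apply_apply _
    · exact congrFun hh e

theorem tensorLinearHom_bijective :
    Function.Bijective fun w : (R ⟶ T) × Labelling k R => tensorLinearHom w.1 w.2 := by
  constructor
  · rintro ⟨h, a⟩ ⟨h', a'⟩ e
    have := congrArg Operad.Hom.onCol e
    simp only [onCol_tensorLinearHom] at this
    refine Prod.ext (T.isThin_operad.hom_ext (funext fun e => ?_)) (Subtype.ext (funext fun e => ?_))
    · exact congrArg Prod.fst (congrFun this e)
    · exact (linearEdge k.len).symm.injective (congrArg Prod.snd (congrFun this e))
  · intro z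
    have hz := fun (n : ℕ) (p : R.operad.Op n) =>
      (exists_op_bvTensor_linear_iff' _ _).1 (exists_op_of_hom z p)
    obtain ⟨h, hh⟩ := T.isThin_operad.exists_hom (P := R.operad) (fun e => (z.onCol e).1)
      fun n p => ⟨⟨(fun i => (z.onCol (R.operad.src p i)).1, (z.onCol (R.operad.tgt p)).1),
        (hz n p).1⟩, rfl, rfl⟩
    refine ⟨(h, ⟨fun e => linearEdge k.len (z.onCol e).2,
      fun n c d hcd => (hz n ⟨(c, d), hcd⟩).2⟩), ?_⟩
    refine (isThin_bvTensor_linear' T k.len).hom_ext ?_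
    refine (onCol_tensorLinearHom _ _).trans (funext fun e => Prod.ext ?_ ?_)
    · exact congrFun hh e
    · exact (linearEdge k.len).symm_apply_apply _

theorem comp_linearTensorHom (g : R' ⟶ R) (a : Labelling k R) (h : R ⟶ T) :
    toOperad.map g ≫ linearTensorHom a h = linearTensorHom (a.pull g) (g ≫ h) := by
  refine (isThin_bvTensor_linear k.len T).hom_ext ?_
  change (linearTensorHom a h).onCol ∘ g.onCol = _
  rw [onCol_linearTensorHom, onCol_linearTensorHom]
  rfl

theorem comp_tensorLinearHom (g : R' ⟶ R) (h : R ⟶ T) (a : Labelling k R) :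
    toOperad.map g ≫ tensorLinearHom h a = tensorLinearHom (g ≫ h) (a.pull g) := by
  refine (isThin_bvTensor_linear' T k.len).hom_ext ?_
  change (tensorLinearHom h a).onCol ∘ g.onCol = _
  rw [onCol_tensorLinearHom, onCol_tensorLinearHom]
  rfl

theorem onCol_ofSimplex_map (u : k ⟶ l) (y : Fin (k.len + 1)) :
    (ofSimplex.map u).onCol ((linearEdge k.len).symm y) =
      (linearEdge l.len).symm (u.toOrderHom y) :=
  congrArg (fun y => (linearEdge l.len).symm (u.toOrderHom y)) ((linearEdge k.len).apply_symm_apply y)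

theorem linearTensorHom_comp (a : Labelling k R) (h : R ⟶ T) (u : k ⟶ l) (f : T ⟶ T') :
    linearTensorHom a h ≫ bvTensorMap (toOperad.map (ofSimplex.map u)) (toOperad.map f) =
      linearTensorHom (a.push u) (h ≫ f) := by
  refine (isThin_bvTensor_linear l.len T').hom_ext ?_
  change (fun x => ((ofSimplex.map u).onCol x.1, f.onCol x.2)) ∘ (linearTensorHom a h).onCol = _
  rw [onCol_linearTensorHom, onCol_linearTensorHom]
  exact funext fun e => Prod.ext (onCol_ofSimplex_map u _) rfl

theorem tensorLinearHom_comp (h : R ⟶ T) (a : Labelling k R) (f : T ⟶ T') (u : k ⟶ l) :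
    tensorLinearHom h a ≫ bvTensorMap (toOperad.map f) (toOperad.map (ofSimplex.map u)) =
      tensorLinearHom (h ≫ f) (a.push u) := by
  refine (isThin_bvTensor_linear' T' l.len).hom_ext ?_
  change (fun x => (f.onCol x.1, (ofSimplex.map u).onCol x.2)) ∘ (tensorLinearHom h a).onCol = _
  rw [onCol_tensorLinearHom, onCol_tensorLinearHom]
  exact funext fun e => Prod.ext rfl (onCol_ofSimplex_map u _)

end PairHom

/-! ## The simplicial hom -/

theorem bvTensorMap_comp_id_left {P P' Q Q' Q'' : Operad} (f : P ⟶ P') (g : Q ⟶ Q')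
    (h : Q' ⟶ Q'') :
    bvTensorMap f g ≫ bvTensorMap (𝟙 P') h =
      bvTensorMap (𝟙 P) (g ≫ h) ≫ bvTensorMap f (𝟙 Q'') := by
  rw [← bvTensorMap_comp, ← bvTensorMap_comp, Category.comp_id, Category.id_comp, Category.comp_id]

namespace DSet

open RTree

/-! ### Elements of the tensor product -/

section TensorMk

variable {X Y : DSet}

/-- The element of `X ⊗ Y` with a given representative. -/
def tensorMk {R S T : RTree} (x : X.obj (op S)) (y : Y.obj (op T))
    (z : R.operad ⟶ bvTensor S.operad T.operad) : (tensor X Y).obj (op R) :=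
  Quot.mk _ ⟨S, T, x, y, z⟩

theorem tensorMk_map_left {R S S' T : RTree} (f : S ⟶ S') (x : X.obj (op S')) (y : Y.obj (op T))
    (z : R.operad ⟶ bvTensor S.operad T.operad) :
    tensorMk (X.map f.op x) y z =
      tensorMk x y (z ≫ bvTensorMap (toOperad.map f) (𝟙 T.operad)) := by
  have := Quot.sound (TensorRel.mk f (𝟙 T) x y z)
  rw [op_id, Functor.map_id_apply] at this
  exact this

theorem tensorMk_map_right {R S T T' : RTree} (g : T ⟶ T') (x : X.obj (op S)) (y : Y.obj (op T'))
    (z : R.operad ⟶ bvTensor S.operad T.operad) :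
    tensorMk x (Y.map g.op y) z =
      tensorMk x y (z ≫ bvTensorMap (𝟙 S.operad) (toOperad.map g)) := by
  have := Quot.sound (TensorRel.mk (𝟙 S) g x y z)
  rw [op_id, Functor.map_id_apply] at this
  exact this

/-- The co-Yoneda reduction: each element of `X ⊗ Ω[T']` has a representative whose second component
is the identity. -/
theorem tensorMk_yoneda {R S T T' : RTree} (x : X.obj (op S)) (g : T ⟶ T')
    (z : R.operad ⟶ bvTensor S.operad T.operad) :
    tensorMk (Y := yoneda.obj T') x g z =
      tensorMk (Y := yoneda.obj T') x (𝟙 T') (z ≫ bvTensorMap (𝟙 S.operad) (toOperad.map g)) := by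
  rw [← tensorMk_map_right]
  exact congrArg (fun y => tensorMk (Y := yoneda.obj T') x y z) (Category.comp_id g).symm

end TensorMk

theorem tensorLinearHom_comp_left {R T T' : RTree} {k : SimplexCategory} (h : R ⟶ T)
    (a : Labelling k R) (f : T ⟶ T') :
    tensorLinearHom h a ≫ bvTensorMap (toOperad.map f) (𝟙 (ofSimplex.obj k).operad) =
      tensorLinearHom (h ≫ f) a := by
  have := tensorLinearHom_comp h a f (𝟙 k)
  rw [ofSimplex.map_id] at this
  exact this

theorem tensorLinearHom_comp_right {R T : RTree} {k l : SimplexCategory} (h : R ⟶ T)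
    (a : Labelling k R) (u : k ⟶ l) :
    tensorLinearHom h a ≫ bvTensorMap (𝟙 T.operad) (toOperad.map (ofSimplex.map u)) =
      tensorLinearHom h (a.push u) := by
  have := tensorLinearHom_comp h a (𝟙 T) u
  rw [Category.comp_id] at this
  exact this

/-! ### The tensor product with `Ω[k]` as a cartesian product -/

variable (X Y : DSet)

/-- The dendroidal set `R ↦ X_R × {labellings of R in [k]}`. -/
abbrev prodLabellings (k : SimplexCategory) : DSet :=
  FunctorToTypes.prod X (labellings.obj k)

variable {X}

/-- The element of `X_R × {labellings of R in [k]}` with given components. -/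
def prodLabellingsMk {k : SimplexCategory} {R : RTree} (x : X.obj (op R)) (a : Labelling k R) :
    (X.prodLabellings k).obj (op R) := (x, a)

theorem prodLabellings_naturality {Y : DSet} {k : SimplexCategory} {R R' : RTree}
    (φ : X.prodLabellings k ⟶ Y) (g : R' ⟶ R) (x : X.obj (op R)) (a : Labelling k R) :
    φ.app (op R') (prodLabellingsMk (X.map g.op x) (a.pull g)) =
      Y.map g.op (φ.app (op R) (prodLabellingsMk x a)) :=
  NatTrans.naturality_apply φ g.op (prodLabellingsMk x a)

theorem prodLabellings_hom_ext {Y : DSet} {k : SimplexCategory} {φ ψ : X.prodLabellings k ⟶ Y}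
    (h : ∀ (R : RTree) (x : X.obj (op R)) (a : Labelling k R),
      φ.app (op R) (prodLabellingsMk x a) = ψ.app (op R) (prodLabellingsMk x a)) : φ = ψ :=
  presheaf_hom_ext fun R w => h R w.1 w.2

variable (X)

/-- The functoriality of `X × labellings.obj k` in `k`. -/
def prodLabellingsMap {k l : SimplexCategory} (u : k ⟶ l) :
    X.prodLabellings k ⟶ X.prodLabellings l :=
  presheafHom (fun _ w => prodLabellingsMk w.1 (w.2.push u)) fun _ _ _ _ => rfl

/-- The map `X × labellings.obj k ⟶ X ⊗ Ω[k]`. -/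
noncomputable def prodLabellingsToTensor (k : SimplexCategory) :
    X.prodLabellings k ⟶ tensor X (yoneda.obj (ofSimplex.obj k)) :=
  presheafHom (fun R w => tensorMk (Y := yoneda.obj (ofSimplex.obj k)) w.1 (𝟙 _)
    (tensorLinearHom (𝟙 R) w.2)) (by
    rintro R R' g ⟨x, a⟩
    refine (tensorMk_map_left (Y := yoneda.obj (ofSimplex.obj k)) g x (𝟙 _) _).trans ?_
    refine congrArg (tensorMk (Y := yoneda.obj (ofSimplex.obj k)) x (𝟙 _)) ?_
    refine (tensorLinearHom_comp_left (𝟙 R') (a.pull g) g).trans ?_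
    rw [Category.id_comp, ← Category.comp_id g]
    exact (comp_tensorLinearHom g (𝟙 R) a).symm)

/-- A map into `Ω(T) ⊗ Ω[k]` amounts to a map of trees and a labelling. -/
noncomputable def tensorLinearEquiv (R T : RTree) (k : SimplexCategory) :
    (R ⟶ T) × Labelling k R ≃ (R.operad ⟶ bvTensor T.operad (ofSimplex.obj k).operad) :=
  Equiv.ofBijective _ tensorLinearHom_bijective

variable {X} in
/-- The element of `X_R × {labellings of R in [k]}` given by a representative of an element of
`X ⊗ Ω[k]`. -/
noncomputable def splitRep {k : SimplexCategory} {R : RTree}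
    (t : TensorRep X (yoneda.obj (ofSimplex.obj k)) R) : (X.prodLabellings k).obj (op R) :=
  prodLabellingsMk
    (X.map ((tensorLinearEquiv R t.S k).symm
      (t.z ≫ bvTensorMap (𝟙 t.S.operad) (toOperad.map t.y))).1.op t.x)
    ((tensorLinearEquiv R t.S k).symm (t.z ≫ bvTensorMap (𝟙 t.S.operad) (toOperad.map t.y))).2

variable {X} in
theorem splitRep_eq {k : SimplexCategory} {R S T : RTree} (x : X.obj (op S))
    (y : T ⟶ ofSimplex.obj k) (z : R.operad ⟶ bvTensor S.operad T.operad) (h : R ⟶ S)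
    (a : Labelling k R)
    (e : z ≫ bvTensorMap (𝟙 S.operad) (toOperad.map y) = tensorLinearHom h a) :
    splitRep (X := X) ⟨S, T, x, y, z⟩ = prodLabellingsMk (X.map h.op x) a := by
  have : (tensorLinearEquiv R S k).symm (z ≫ bvTensorMap (𝟙 S.operad) (toOperad.map y)) = (h, a) :=
    (Equiv.symm_apply_eq _).2 e
  simp only [splitRep, this]

/-- Decompose the map with the second tree already pushed into `Ω[k]`. Changing the first tree along
`f` then only postcomposes the tree map with `f`, which functoriality of `X` accounts for. -/
theorem splitRep_congr {k : SimplexCategory} {R : RTree}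
    {s t : TensorRep X (yoneda.obj (ofSimplex.obj k)) R} (h : TensorRel X _ R s t) :
    splitRep s = splitRep t := by
  obtain ⟨f, g, x, y, z⟩ := h
  rename_i S S' T T'
  change T' ⟶ ofSimplex.obj k at y
  change R.operad ⟶ bvTensor S.operad T.operad at z
  obtain ⟨⟨h, a⟩, e⟩ := tensorLinearHom_bijective.2
    (z ≫ bvTensorMap (𝟙 S.operad) (toOperad.map (g ≫ y)))
  refine (splitRep_eq (X.map f.op x) (g ≫ y) z h a e.symm).trans ?_
  rw [← Functor.map_comp_apply, ← op_comp]
  refine (splitRep_eq x y (z ≫ bvTensorMap (toOperad.map f) (toOperad.map g)) (h ≫ f) a ?_).symm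
  rw [← tensorLinearHom_comp_left h a f]
  refine (Category.assoc z _ _).trans ((congrArg (z ≫ ·) (bvTensorMap_comp_id_left _ _ _)).trans
    ((Category.assoc z _ _).symm.trans ?_))
  exact congrArg (· ≫ bvTensorMap (toOperad.map f) (𝟙 (ofSimplex.obj k).operad)) e.symm

/-- The map `splitRep` descends to a left inverse. For surjectivity, move the second component to
the identity, split the resulting map into a tree map `h` and a labelling, and absorb `h` into `x`.
-/
theorem prodLabellingsToTensor_bijective (k : SimplexCategory) (R : RTree) :
    Function.Bijective ((X.prodLabellingsToTensor k).app (op R)) := by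
  constructor
  · refine Function.LeftInverse.injective
      (g := Quot.lift splitRep fun _ _ => splitRep_congr X) ?_
    rintro ⟨x, a⟩
    have h2 := tensorLinearHom_comp_right (𝟙 R) a (𝟙 k)
    rw [ofSimplex.map_id] at h2
    refine (splitRep_eq x (𝟙 _) (tensorLinearHom (𝟙 R) a) (𝟙 R) a h2).trans ?_
    rw [op_id, X.map_id]
    rfl
  · intro t
    induction t using Quot.inductionOn with | h t => ?_
    obtain ⟨S, T, x, y, z⟩ := t
    change T ⟶ ofSimplex.obj k at y
    change R.operad ⟶ bvTensor S.operad T.operad at z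
    obtain ⟨⟨h, a⟩, e⟩ := tensorLinearHom_bijective.2
      (z ≫ bvTensorMap (𝟙 S.operad) (toOperad.map y))
    refine ⟨prodLabellingsMk (X.map h.op x) a, ?_⟩
    refine (tensorMk_map_left (Y := yoneda.obj (ofSimplex.obj k)) h x (𝟙 _)
      (tensorLinearHom (𝟙 R) a)).trans (Eq.trans ?_ (tensorMk_yoneda x y z).symm)
    refine congrArg (tensorMk (Y := yoneda.obj (ofSimplex.obj k)) x (𝟙 _)) ?_
    refine (tensorLinearHom_comp_left (𝟙 R) a h).trans ?_
    rw [Category.id_comp]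
    exact e

/-- The isomorphism `X ⊗ Ω[k] ≅ X × labellings.obj k`. -/
noncomputable def prodLabellingsIso (k : SimplexCategory) :
    X.prodLabellings k ≅ tensor X (yoneda.obj (ofSimplex.obj k)) :=
  have (R : RTreeᵒᵖ) : IsIso ((X.prodLabellingsToTensor k).app R) :=
    (isIso_iff_bijective _).2 (X.prodLabellingsToTensor_bijective k R.unop)
  have : IsIso (X.prodLabellingsToTensor k) := NatIso.isIso_of_isIso_app _
  asIso (X.prodLabellingsToTensor k)

theorem prodLabellingsMap_comp_toTensor {k l : SimplexCategory} (u : k ⟶ l) :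
    X.prodLabellingsMap u ≫ X.prodLabellingsToTensor l =
      X.prodLabellingsToTensor k ≫ tensorMap (𝟙 X) (yoneda.map (ofSimplex.map u)) := by
  refine prodLabellings_hom_ext fun R x a => ?_
  refine Eq.trans ?_ ((congrArg (fun y => tensorMk (Y := yoneda.obj (ofSimplex.obj l)) x y
    (tensorLinearHom (𝟙 R) a)) (Category.id_comp (ofSimplex.map u))).trans
      (tensorMk_yoneda x (ofSimplex.map u) (tensorLinearHom (𝟙 R) a))).symm
  exact congrArg (tensorMk (Y := yoneda.obj (ofSimplex.obj l)) x (𝟙 _))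
    (tensorLinearHom_comp_right (𝟙 R) a u).symm

/-- The simplicial set `k ↦ Hom(X × labellings.obj k, Y)`. -/
def labellingHom : SSet.{0} where
  obj k := X.prodLabellings k.unop ⟶ Y
  map u := TypeCat.ofHom fun φ => X.prodLabellingsMap u.unop ≫ φ

/-- The simplicial hom as a simplicial set of maps from `X × labellings.obj k`. -/
noncomputable def sHomIso : sHom X Y ≅ labellingHom X Y :=
  NatIso.ofComponents
    (fun k => Equiv.toIso ((X.prodLabellingsIso k.unop).symm.homFromEquiv))
    (by
      intro k l u
      refine ConcreteCategory.hom_ext _ _ fun φ => ?_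
      exact (Category.assoc _ _ _).symm.trans
        ((congrArg (· ≫ φ) (X.prodLabellingsMap_comp_toTensor u.unop).symm).trans
          (Category.assoc _ _ _)))

/-! ### Coskeletality of the simplicial hom -/

variable {X Y}

theorem labellingHom_naturality {k l : SimplexCategory} (u : k ⟶ l)
    (φ : X.prodLabellings l ⟶ Y) {R : RTree} (x : X.obj (op R)) (a : Labelling k R) :
    NatTrans.app ((labellingHom X Y).map u.op φ : X.prodLabellings k ⟶ Y) (op R)
      (prodLabellingsMk x a) = φ.app (op R) (prodLabellingsMk x (a.push u)) := rfl

/-- On a tree of size at most `n`, every labelling in `[k]` comes from a simplex of dimension at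
most `n`, where the given family prescribes the value; coskeletality of `Y` extends the result to
all trees. -/
theorem isCoskeletal_labellingHom {n : ℕ} (hY : IsCoskeletal (fun T : RTree => T.size ≤ n) Y) :
    IsCoskeletal (fun k : SimplexCategory => k.len ≤ n) (labellingHom X Y) := by
  intro k (s : ∀ l : SimplexCategory, l.len ≤ n → (l ⟶ k) → (X.prodLabellings l ⟶ Y)) hs
  have hs' : ∀ (l l' : SimplexCategory) (hl : l.len ≤ n) (hl' : l'.len ≤ n) (g : l' ⟶ l)
      (f : l ⟶ k) {R : RTree} (x : X.obj (op R)) (a : Labelling l' R),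
      (s l hl f).app (op R) (prodLabellingsMk x (a.push g)) =
        (s l' hl' (g ≫ f)).app (op R) (prodLabellingsMk x a) := by
    intro l l' hl hl' g f R x a
    rw [← hs l l' hl hl' g f]
    rfl
  choose l u r hl hu hr using fun (R : RTree) (a : Labelling k R) => a.exists_factorization
  -- The prescribed value does not depend on the factorization: any small simplex `j` over `k` with
  -- a labelling `b` inducing the given one yields the value at the chosen factorization.
  have key : ∀ (R : RTree) (hR : R.size ≤ n) (x : X.obj (op R)) (j : SimplexCategory)
      (hj : j.len ≤ n) (f : j ⟶ k) (b : Labelling j R),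
      (s j hj f).app (op R) (prodLabellingsMk x b) =
        (s _ ((hl R (b.push f)).trans hR) (u R (b.push f))).app (op R)
          (prodLabellingsMk x ((b.push f).push (r R (b.push f)))) := by
    intro R hR x j hj f b
    obtain ⟨i, v, q, hi, hv, hq⟩ := b.exists_factorization
    obtain ⟨c, rfl⟩ : ∃ c : Labelling i R, b = c.push v := ⟨_, hq.symm⟩
    -- Every vertex in the image of `v` is a label used by `b`, so `f` sends it to a label of the
    -- pushed labelling, which `r` followed by `u` fixes. Both values can thus be compared over the
    -- small simplex `i`.
    have hvf : v ≫ f = (v ≫ f ≫ r R ((c.push v).push f)) ≫ u R ((c.push v).push f) := by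
      refine SimplexCategory.Hom.ext _ _ (OrderHom.ext _ _ (funext fun y => ?_))
      obtain ⟨e, he⟩ := hv y
      have h1 := congrFun (congrArg Subtype.val (hr R ((c.push v).push f))) e
      refine (congrArg f.toOrderHom he).trans (h1.symm.trans ?_)
      exact congrArg (fun y => (f ≫ r R ((c.push v).push f) ≫ u R _).toOrderHom y) he.symm
    refine (hs' j i hj (hi.trans hR) v f x c).trans (Eq.trans ?_
      (hs' _ i _ (hi.trans hR) (v ≫ f ≫ r R ((c.push v).push f)) (u R _) x c).symm)
    rw [← hvf]
  obtain ⟨φ, hφ⟩ := hY.exists_hom (W := X.prodLabellings k)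
    (fun R hR w => (s _ ((hl R w.2).trans hR) (u R w.2)).app (op R)
      (prodLabellingsMk w.1 (w.2.push (r R w.2)))) (by
      rintro R R' hR hR' g ⟨x, a⟩
      rw [← prodLabellings_naturality]
      refine Eq.trans ?_ (key R' hR' _ _ _ _ _).symm
      have : ((a.push (r R a)).pull g).push (u R a) = a.pull g :=
        congrArg (fun a => a.pull g) (hr R a)
      rw [this]
      rfl)
  have hφ' : ∀ (R : RTree) (hR : R.size ≤ n) (x : X.obj (op R)) (a : Labelling k R),
      φ.app (op R) (prodLabellingsMk x a) = (s _ ((hl R a).trans hR) (u R a)).app (op R)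
        (prodLabellingsMk x (a.push (r R a))) := fun R hR x a => hφ R hR (prodLabellingsMk x a)
  refine ⟨φ, ?_, ?_⟩
  · intro j hj f
    refine hY.hom_ext ?_
    rintro R hR ⟨x, a⟩
    refine (hφ' R hR x (a.push f)).trans ?_
    exact (key R hR x j hj f a).symm
  · intro (φ' : X.prodLabellings k ⟶ Y) h'
    refine hY.hom_ext ?_
    rintro R hR ⟨x, (a : Labelling k R)⟩
    refine Eq.trans ?_ (hφ' R hR x a).symm
    rw [← h' _ _ _, labellingHom_naturality]
    exact congrArg (fun a => φ'.app (op R) (prodLabellingsMk x a)) (hr R a).symm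

end DSet

/-! ## The cotensor -/

section Labelled

variable (M : SSet.{0})

/-- The identifications in the coend `∫^k M_k × {labellings of R in [k]}`. -/
inductive LabellingRel (R : RTree) :
    (Σ k : SimplexCategory, M.obj (op k) × Labelling k R) →
      (Σ k : SimplexCategory, M.obj (op k) × Labelling k R) → Prop
  | mk {k l : SimplexCategory} (u : k ⟶ l) (m : M.obj (op l)) (a : Labelling k R) :
      LabellingRel R ⟨k, M.map u.op m, a⟩ ⟨l, m, a.push u⟩

/-- The dendroidal set `R ↦ ∫^k M_k × {labellings of R in [k]}`. -/
def labelledBy : DSet where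
  obj R := Quot (LabellingRel M R.unop)
  map {R R'} g := TypeCat.ofHom (Quot.map (fun t => ⟨t.1, t.2.1, t.2.2.pull g.unop⟩) (by
    rintro _ _ ⟨u, m, a⟩
    exact LabellingRel.mk u m (a.pull g.unop)))
  map_id R := by
    refine ConcreteCategory.hom_ext _ _ fun t => ?_
    induction t using Quot.inductionOn with | h t => ?_
    rfl
  map_comp f g := by
    refine ConcreteCategory.hom_ext _ _ fun t => ?_
    induction t using Quot.inductionOn with | h t => ?_
    rfl

variable {M}

/-- The element of `labelledBy M` given by a simplex and a labelling. -/
def labelledByMk {R : RTree} {k : SimplexCategory} (m : M.obj (op k)) (a : Labelling k R) :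
    (labelledBy M).obj (op R) := Quot.mk _ ⟨k, m, a⟩

theorem labelledByMk_map {R : RTree} {k l : SimplexCategory} (u : k ⟶ l) (m : M.obj (op l))
    (a : Labelling k R) : labelledByMk (M.map u.op m) a = labelledByMk m (a.push u) :=
  Quot.sound (LabellingRel.mk u m a)

theorem exists_labelledByMk {R : RTree} (t : (labelledBy M).obj (op R)) :
    ∃ (k : SimplexCategory) (m : M.obj (op k)) (a : Labelling k R), t = labelledByMk m a := by
  induction t using Quot.inductionOn with | h t => ?_
  exact ⟨t.1, t.2.1, t.2.2, rfl⟩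

/-- Factoring the labelling moves any representative to a simplex of dimension at most `R.size`,
leaving finitely many candidates. -/
theorem finite_labelledBy (hM : SSetDegreewiseFinite M) (R : RTree) :
    Finite ((labelledBy M).obj (op R)) := by
  have (i : Fin (R.size + 1)) : Finite (M.obj (op (SimplexCategory.mk i))) := hM _
  refine Finite.of_surjective
    (fun t : Σ i : Fin (R.size + 1), M.obj (op (SimplexCategory.mk i)) ×
      Labelling (SimplexCategory.mk i) R => labelledByMk t.2.1 t.2.2) fun t => ?_
  obtain ⟨k, m, a, rfl⟩ := exists_labelledByMk t
  obtain ⟨l, u, r, hl, -, hr⟩ := a.exists_factorization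
  refine ⟨⟨⟨l.len, Nat.lt_succ_of_le hl⟩, M.map u.op m, a.push r⟩, ?_⟩
  refine (labelledByMk_map u m (a.push r)).trans ?_
  rw [hr]

end Labelled

/-! ### Maps out of `X ⊗ Ω[T]` -/

namespace DSet

open RTree

/-- The dendroidal set `S ↦ Hom(Ω[S] ⊗ Ω[T], Y)`. -/
noncomputable def nerveHom (T : RTree) (Y : DSet) : DSet where
  obj S := nerve.obj (bvTensor S.unop.operad T.operad) ⟶ Y
  map f := TypeCat.ofHom fun φ => nerve.map (bvTensorMap (toOperad.map f.unop) (𝟙 T.operad)) ≫ φ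
  map_id S := ConcreteCategory.hom_ext _ _ fun φ => by
    change nerve.map (bvTensorMap (𝟙 S.unop.operad) (𝟙 T.operad)) ≫ φ = φ
    rw [bvTensorMap_id, nerve.map_id, Category.id_comp]
  map_comp f g := ConcreteCategory.hom_ext _ _ fun φ => by
    have := bvTensorMap_comp (toOperad.map g.unop) (toOperad.map f.unop) (𝟙 T.operad) (𝟙 T.operad)
    rw [Category.comp_id, ← toOperad.map_comp] at this
    refine (congrArg (fun u => nerve.map u ≫ φ) this).trans ?_
    exact (congrArg (· ≫ φ) (nerve.map_comp _ _)).trans (Category.assoc _ _ _)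

variable {X Y : DSet}

/-- An element of the nerve of an operad. -/
def nerveMk {P : Operad} {R : RTree} (z : R.operad ⟶ P) : (nerve.obj P).obj (op R) := z

theorem tensor_yoneda_hom_ext {T : RTree} {φ ψ : tensor X (yoneda.obj T) ⟶ Y}
    (h : ∀ (R S : RTree) (x : X.obj (op S)) (z : R.operad ⟶ bvTensor S.operad T.operad),
      φ.app (op R) (tensorMk (Y := yoneda.obj T) x (𝟙 T) z) =
        ψ.app (op R) (tensorMk (Y := yoneda.obj T) x (𝟙 T) z)) : φ = ψ := by
  refine presheaf_hom_ext fun R t => ?_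
  induction t using Quot.inductionOn with | h t => ?_
  obtain ⟨S, T', x, g, z⟩ := t
  have := tensorMk_yoneda x g z
  exact (congrArg (φ.app (op R)) this).trans ((h _ _ _ _).trans (congrArg (ψ.app (op R)) this).symm)

/-- With `tensor_yoneda_hom_ext`, this gives the closed structure in the form needed: maps `X ⊗ Ω[T]
⟶ Y` are built from maps `X ⟶ nerveHom T Y`. -/
theorem exists_tensor_yoneda_hom {T : RTree} (ψ : X ⟶ nerveHom T Y) :
    ∃ φ : tensor X (yoneda.obj T) ⟶ Y, ∀ (R S : RTree) (x : X.obj (op S))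
      (z : R.operad ⟶ bvTensor S.operad T.operad),
      φ.app (op R) (tensorMk (Y := yoneda.obj T) x (𝟙 T) z) =
        NatTrans.app (ψ.app (op S) x : nerve.obj (bvTensor S.operad T.operad) ⟶ Y) (op R)
          (nerveMk z) := by
  let F : ∀ R : RTree, TensorRep X (yoneda.obj T) R → Y.obj (op R) := fun R t =>
    NatTrans.app (ψ.app (op t.S) t.x : nerve.obj (bvTensor t.S.operad T.operad) ⟶ Y) (op R)
      (nerveMk (t.z ≫ bvTensorMap (𝟙 t.S.operad) (toOperad.map t.y)))
  have hF : ∀ (R : RTree) (s t : TensorRep X (yoneda.obj T) R),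
      TensorRel X (yoneda.obj T) R s t → F R s = F R t := by
    rintro R _ _ ⟨f, g, x, y, z⟩
    rename_i S S' U U'
    change U' ⟶ T at y
    change R.operad ⟶ bvTensor S.operad U.operad at z
    have h1 : ψ.app (op S) (X.map f.op x) = (nerveHom T Y).map f.op (ψ.app (op S') x) :=
      NatTrans.naturality_apply ψ f.op x
    have h2 := (Category.assoc z _ _).trans ((congrArg (z ≫ ·) (bvTensorMap_comp_id_left
      (toOperad.map f) (toOperad.map g) (toOperad.map y))).trans (Category.assoc z _ _).symm)
    refine (congrArg (fun φ : nerve.obj (bvTensor S.operad T.operad) ⟶ Y => φ.app (op R)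
      (nerveMk (z ≫ bvTensorMap (𝟙 S.operad) (toOperad.map (g ≫ y))))) h1).trans ?_
    exact congrArg (fun z => NatTrans.app
      (ψ.app (op S') x : nerve.obj (bvTensor S'.operad T.operad) ⟶ Y) (op R) (nerveMk z)) h2.symm
  refine ⟨presheafHom (fun R => Quot.lift (F R) (hF R)) ?_, ?_⟩
  · intro R R' g t
    induction t using Quot.inductionOn with | h t => ?_
    exact NatTrans.naturality_apply
      (ψ.app (op t.S) t.x : nerve.obj (bvTensor t.S.operad T.operad) ⟶ Y) g.op
      (nerveMk (t.z ≫ bvTensorMap (𝟙 t.S.operad) (toOperad.map t.y)))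
  · intro R S x z
    have h : z ≫ bvTensorMap (𝟙 S.operad) (toOperad.map (𝟙 T)) = z :=
      (congrArg (z ≫ ·) (bvTensorMap_id S.operad T.operad)).trans (Category.comp_id z)
    exact congrArg (fun z => NatTrans.app
      (ψ.app (op S) x : nerve.obj (bvTensor S.operad T.operad) ⟶ Y) (op R) (nerveMk z)) h

/-- The map `X ⟶ nerveHom T Y` corresponding to a map `X ⊗ Ω[T] ⟶ Y`. -/
noncomputable def toNerveHom {T : RTree} (φ : tensor X (yoneda.obj T) ⟶ Y) : X ⟶ nerveHom T Y :=
  presheafHom (fun S x => presheafHom (W := nerve.obj (bvTensor S.operad T.operad))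
      (fun R z => φ.app (op R) (tensorMk (Y := yoneda.obj T) x (𝟙 T) z))
      fun R _ g z => NatTrans.naturality_apply φ g.op (tensorMk (R := R) (Y := yoneda.obj T) x (𝟙 T) z))
    fun _ _ f x => presheaf_hom_ext fun R z =>
      congrArg (φ.app (op R)) (tensorMk_map_left (Y := yoneda.obj T) f x (𝟙 T) z)

/-! ### The cotensor as a cartesian exponential -/

section Cotensor

variable (M : SSet.{0})

/-- The adjunction between `i_!` and `i^*`. -/
noncomputable def ofSSetAdjunction : ofSSet ⊣ toSSet :=
  ofSimplex.op.lanAdjunction Type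

variable {M} in
/-- The element of `i_! M` at a linear tree given by a simplex of `M`. -/
noncomputable def ofSSetMk {k : SimplexCategory} (m : M.obj (op k)) :
    (ofSSet.obj M).obj (op (ofSimplex.obj k)) :=
  (ofSSetAdjunction.unit.app M).app (op k) m

variable {M} in
theorem ofSSetMk_map {k l : SimplexCategory} (u : k ⟶ l) (m : M.obj (op l)) :
    ofSSetMk (M.map u.op m) = (ofSSet.obj M).map (ofSimplex.map u).op (ofSSetMk m) :=
  NatTrans.naturality_apply (ofSSetAdjunction.unit.app M) u.op m

variable {M} in
-- The left Kan extension `i_! M` enters only through its adjunction, so it is handled by maps out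
-- of it, which are determined on the simplices of `M`.
theorem ofSSet_hom_ext {φ ψ : ofSSet.obj M ⟶ Y} (h : ∀ (k : SimplexCategory) (m : M.obj (op k)),
    φ.app (op (ofSimplex.obj k)) (ofSSetMk m) = ψ.app (op (ofSimplex.obj k)) (ofSSetMk m)) :
    φ = ψ := by
  refine (ofSSetAdjunction.homEquiv _ _).injective ?_
  rw [Adjunction.homEquiv_unit, Adjunction.homEquiv_unit]
  exact presheaf_hom_ext fun k m => h k m

variable {M} in
theorem exists_ofSSet_hom (ψ : M ⟶ toSSet.obj Y) : ∃ φ : ofSSet.obj M ⟶ Y,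
    ∀ (k : SimplexCategory) (m : M.obj (op k)),
      φ.app (op (ofSimplex.obj k)) (ofSSetMk m) = ψ.app (op k) m := by
  refine ⟨(ofSSetAdjunction.homEquiv _ _).symm ψ, fun k m => ?_⟩
  have := (ofSSetAdjunction.homEquiv _ _).apply_symm_apply ψ
  rw [Adjunction.homEquiv_unit] at this
  exact ConcreteCategory.congr_hom (congr_app this (op k)) m

/-- The map `labelledBy M × Ω[T] ⟶ i_! M ⊗ Ω[T]`. -/
noncomputable def labelledByToTensor (T : RTree) :
    prodYoneda (labelledBy M) T ⟶ tensor (ofSSet.obj M) (yoneda.obj T) :=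
  presheafHom (fun R w => Quot.lift (fun t : Σ k : SimplexCategory, M.obj (op k) × Labelling k R =>
      tensorMk (Y := yoneda.obj T) (ofSSetMk t.2.1) (𝟙 T) (linearTensorHom t.2.2 w.2)) (by
        rintro _ _ ⟨u, m, a⟩
        dsimp only
        rw [ofSSetMk_map]
        refine (tensorMk_map_left (Y := yoneda.obj T) _ _ _ _).trans ?_
        have := linearTensorHom_comp a w.2 u (𝟙 T)
        rw [Category.comp_id] at this
        exact congrArg (tensorMk (Y := yoneda.obj T) _ _) this) w.1) (by
    rintro R R' g ⟨t, h⟩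
    obtain ⟨k, m, a, rfl⟩ := exists_labelledByMk t
    exact congrArg (tensorMk (Y := yoneda.obj T) (ofSSetMk m) (𝟙 T))
      (comp_linearTensorHom g a h).symm)

/-- A map into `Ω[k] ⊗ Ω(T)` amounts to a labelling and a map of trees. -/
noncomputable def linearTensorEquiv (R T : RTree) (k : SimplexCategory) :
    Labelling k R × (R ⟶ T) ≃ (R.operad ⟶ bvTensor (ofSimplex.obj k).operad T.operad) :=
  Equiv.ofBijective _ linearTensorHom_bijective

/-- Since `i_!` is known through maps out of it, the comparison is made after mapping into `Y`. A
map from `i_! M ⊗ Ω[T]` is a map `M ⟶ i^* (nerveHom T Y)`, that is, a compatible family of maps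
`Ω[k] ⊗ Ω[T] ⟶ Y` indexed by simplices; splitting `Ω[k] ⊗ Ω[T]` turns it into a map from `labelledBy
M × Ω[T]`. -/
theorem labelledByToTensor_comp_bijective (T : RTree) (Y : DSet) : Function.Bijective
    fun φ : tensor (ofSSet.obj M) (yoneda.obj T) ⟶ Y => labelledByToTensor M T ≫ φ := by
  constructor
  · intro φ ψ h
    have key : toNerveHom φ = toNerveHom ψ := by
      refine ofSSet_hom_ext fun k m => presheaf_hom_ext fun R z => ?_
      obtain ⟨⟨a, u⟩, rfl⟩ := linearTensorHom_bijective.2 z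
      exact ConcreteCategory.congr_hom (congr_app h (op R)) (prodYonedaMk (labelledByMk m a) u)
    refine tensor_yoneda_hom_ext fun R S x z => ?_
    have h1 := ConcreteCategory.congr_hom (congr_app key (op S)) x
    exact congrArg (fun φ : nerve.obj (bvTensor S.operad T.operad) ⟶ Y =>
      φ.app (op R) (nerveMk z)) h1
  · intro χ
    -- For each simplex `m`, read a map into `Ω[k] ⊗ Ω(T)` as a pair of a labelling and a tree map,
    -- and apply `χ`.
    let F : ∀ (k : SimplexCategory) (m : M.obj (op k)) (R : RTree),
        (R.operad ⟶ bvTensor (ofSimplex.obj k).operad T.operad) → Y.obj (op R) := fun k m R z =>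
      χ.app (op R) (prodYonedaMk
        (labelledByMk m ((linearTensorEquiv R T k).symm z).1) ((linearTensorEquiv R T k).symm z).2)
    have hF : ∀ (k : SimplexCategory) (m : M.obj (op k)) (R : RTree) (a : Labelling k R)
        (u : R ⟶ T), F k m R (linearTensorHom a u) =
          χ.app (op R) (prodYonedaMk (labelledByMk m a) u) := by
      intro k m R a u
      have : (linearTensorEquiv R T k).symm (linearTensorHom a u) = (a, u) :=
        (linearTensorEquiv R T k).symm_apply_apply (a, u)
      simp only [F, this]
    have hF' : ∀ (k : SimplexCategory) (m : M.obj (op k)) (R R' : RTree) (g : R' ⟶ R)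
        (z : (nerve.obj (bvTensor (ofSimplex.obj k).operad T.operad)).obj (op R)),
        F k m R' ((nerve.obj (bvTensor (ofSimplex.obj k).operad T.operad)).map g.op z) =
          Y.map g.op (F k m R z) := by
      intro k m R R' g z
      obtain ⟨⟨a, u⟩, rfl⟩ := linearTensorHom_bijective.2 z
      refine (congrArg (F k m R') (comp_linearTensorHom g a u)).trans ?_
      refine (hF k m R' _ _).trans (Eq.trans ?_ (congrArg (Y.map g.op) (hF k m R a u)).symm)
      exact prodYoneda_naturality χ (labelledByMk m a) u g
    let ψ : M ⟶ toSSet.obj (nerveHom T Y) := presheafHom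
      (fun k m => presheafHom (W := nerve.obj (bvTensor (ofSimplex.obj k).operad T.operad))
        (F k m) (hF' k m)) (by
        intro l k v m
        refine presheaf_hom_ext (W := nerve.obj (bvTensor (ofSimplex.obj k).operad T.operad))
          fun R z => ?_
        obtain ⟨⟨a, u⟩, rfl⟩ := linearTensorHom_bijective.2 z
        have h1 := linearTensorHom_comp a u v (𝟙 T)
        rw [Category.comp_id] at h1
        refine (hF k (M.map v.op m) R a u).trans ?_
        rw [labelledByMk_map]
        exact ((congrArg (F l m R) h1).trans (hF l m R _ _)).symm)
    obtain ⟨ψ', hψ'⟩ := exists_ofSSet_hom ψ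
    obtain ⟨φ, hφ⟩ := exists_tensor_yoneda_hom ψ'
    refine ⟨φ, prodYoneda_hom_ext fun R t u => ?_⟩
    obtain ⟨k, m, a, rfl⟩ := exists_labelledByMk t
    refine (hφ R _ (ofSSetMk m) (linearTensorHom a u)).trans ?_
    refine (congrArg (fun φ : nerve.obj (bvTensor (ofSimplex.obj k).operad T.operad) ⟶ Y =>
      φ.app (op R) (nerveMk (linearTensorHom a u))) (hψ' k m)).trans ?_
    exact hF k m R a u

theorem prodYonedaMap_comp_labelledByToTensor {T T' : RTree} (f : T ⟶ T') :
    prodYonedaMap (labelledBy M) f ≫ labelledByToTensor M T' =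
      labelledByToTensor M T ≫ tensorMap (𝟙 (ofSSet.obj M)) (yoneda.map f) := by
  refine prodYoneda_hom_ext fun R t h => ?_
  obtain ⟨k, m, a, rfl⟩ := exists_labelledByMk t
  have h1 := linearTensorHom_comp a h (𝟙 k) f
  rw [ofSimplex.map_id] at h1
  refine Eq.trans ?_ ((congrArg (fun y => tensorMk (Y := yoneda.obj T') (ofSSetMk m) y
    (linearTensorHom a h)) (Category.id_comp f)).trans
      (tensorMk_yoneda (ofSSetMk m) f (linearTensorHom a h))).symm
  exact congrArg (tensorMk (Y := yoneda.obj T') (ofSSetMk m) (𝟙 T')) h1.symm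

/-- The cotensor is an exponential for the cartesian product of presheaves. -/
noncomputable def cotensorIso (Y : DSet) : cotensor Y M ≅ exponential (labelledBy M) Y :=
  NatIso.ofComponents
    (fun T => Equiv.toIso (Equiv.ofBijective _ (labelledByToTensor_comp_bijective M T.unop Y)))
    (by
      intro T T' f
      refine ConcreteCategory.hom_ext _ _ fun φ => ?_
      exact (Category.assoc _ _ _).symm.trans
        ((congrArg (· ≫ φ) (prodYonedaMap_comp_labelledByToTensor M f.unop).symm).trans
          (Category.assoc _ _ _)))

end Cotensor

/-! ### Leanness of the cotensor and of the simplicial hom -/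

theorem isCoskeletal_of_isIso_toCosk {n : ℕ} (h : IsIso (toCosk n Y)) :
    IsCoskeletal (fun T : RTree => T.size ≤ n) Y :=
  (isIso_unit_app_iff ((truncInclusion n).op.ranAdjunction Type)).1 h

theorem IsLeanDSet.finite_hom (hY : Y.IsLeanDSet) (hX : X.DegreewiseFinite) : Finite (X ⟶ Y) := by
  obtain ⟨hfin, n, hn⟩ := hY
  have : Finite (ObjectProperty.FullSubcategory fun T : RTree => T.size ≤ n) := finite_trunc n
  exact (isCoskeletal_of_isIso_toCosk hn).finite_hom (fun R _ => hX R) fun R _ => hfin R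

theorem IsLeanDSet.cotensor (hY : Y.IsLeanDSet) {M : SSet.{0}} (hM : SSetDegreewiseFinite M) :
    (Y.cotensor M).IsLeanDSet := by
  refine ⟨fun T => ?_, ?_⟩
  · have : Finite ((exponential (labelledBy M) Y).obj (op T)) := by
      refine hY.finite_hom (X := prodYoneda (labelledBy M) T) fun R => ?_
      have := finite_labelledBy hM R
      exact inferInstanceAs (Finite ((labelledBy M).obj (op R) × (R ⟶ T)))
    exact Finite.of_equiv _ ((cotensorIso M Y).app (op T)).toEquiv.symm
  · obtain ⟨-, n, hn⟩ := hY
    exact ⟨n, (isIso_unit_app_iff ((truncInclusion n).op.ranAdjunction Type)).2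
      (((isCoskeletal_of_isIso_toCosk hn).exponential (labelledBy M)).of_iso
        (cotensorIso M Y).symm)⟩

theorem IsLeanDSet.sHom (hY : Y.IsLeanDSet) (hX : X.DegreewiseFinite) :
    IsLeanSSet (DSet.sHom X Y) := by
  refine ⟨fun k => ?_, ?_⟩
  · have : Finite ((labellingHom X Y).obj (op k)) := by
      refine hY.finite_hom (X := X.prodLabellings k) fun R => ?_
      have := hX R
      exact inferInstanceAs (Finite (X.obj (op R) × Labelling k R))
    exact Finite.of_equiv _ ((sHomIso X Y).app (op k)).toEquiv.symm
  · obtain ⟨-, n, hn⟩ := hY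
    exact ⟨n, (isIso_unit_app_iff (SimplicialObject.coskAdj n)).2
      ((isCoskeletal_labellingHom (isCoskeletal_of_isIso_toCosk hn)).of_iso (sHomIso X Y).symm)⟩

end DSet

end Dendroidal

theorem mainTheorem8 (Y : Dendroidal.DSet) (hY : Y.IsLeanDSet) :
    (∀ M : SSet.{0}, Dendroidal.SSetDegreewiseFinite M → (Y.cotensor M).IsLeanDSet) ∧
      (∀ X : Dendroidal.DSet, X.DegreewiseFinite →
        Dendroidal.IsLeanSSet (Dendroidal.DSet.sHom X Y)) :=
  ⟨fun _ hM => hY.cotensor hM, fun _ hX => hY.sHom hX⟩
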